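/- Let $n\ge 1$ and let the Heisenberg group be $\mathbb R^{2n+1}$, with coordinates $(x,y,z)=(x_1,\dots,x_n,y_1,\dots,y_n,z)$ and multiplication $$(x,y,z)*(x',y',z')=\Bigl(x+x',\,y+y',\,z+z'+\tfrac12\sum_{i=1}^n(y_ix'_i-y'_ix_i)\Bigr).$$ Let $X_i=\partial_{x_i}+\tfrac12y_i\partial_z$, $Y_i=\partial_{y_i}-\tfrac12x_i\partial_z$, let $H$ be the distribution spanned by $X_1,Y_1,\dots,X_n,Y_n$, and for signs $t_i,s_i\in\{-1,1\}$ let $g$ be the metric on $H$ for which this frame is orthogonal with $g(X_i,X_i)=t_i$, $g(Y_i,Y_i)=s_i$. The index $\operatorname{ind}(g)$ is the number of signs equal to $-1$. An isometry is a smooth diffeomorphism $f$ of $\mathbb R^{2n+1}$ with $f_*H=H$ and $g(f_*v,f_*w)=g(v,w)$ for all $v,w\in H_q$ and all points $q$; it is orientation preserving if it preserves the orientations both of $\mathbb R^{2n+1}$ and of the bundle $H$. The group $I(H,g)$ of all isometries and its subgroup $I^+(H,g)$ of orientation preserving ones carry the compact-open topology. (1) For every choice of signs, $X_1,\dots,X_n,Y_1,\dots,Y_n$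 is a smooth global frame of $H$, invariant under left translations and orthonormal for $g$; these fields and their brackets span the tangent space at every point; $\alpha=\tfrac12\sum_i(y_i\,dx_i-x_i\,dy_i)-dz$ is a contact form with kernel $H$, normalised by $\bigl|\tfrac1{n!}(d\alpha)^{n}\bigr|=1$ on the frame; and $\omega=-d\alpha=\sum_{i}dx_i\wedge dy_i$. (2) For every choice of signs, let $Sp(\omega)\cap O(g)$ be the group of linear automorphisms $\sigma$ of $\mathbb R^{2n}$ that preserve both the standard symplectic form and the diagonal form with entries $t_i,s_i$. It acts on the Heisenberg group by the automorphisms $f_\sigma(x,y,z)=(\sigma(x,y),z)$, and $$(p,\sigma)\longmapsto\bigl(q\mapsto p*f_\sigma(q)\bigr)$$ is an isomorphism of groups, and a homeomorphism, from $\mathbb R^{2n+1}\ltimes(Sp(\omega)\cap O(g))$ onto $I^+(H,g)$. (3) For all integers $l,t\ge0$ with $l\le 2n$, $t\le\min\{l,2n-l\}$ and $l-t$ even there are signs with $\operatorname{ind}(g)=l$ such that $I(H,g)$ and $I^+(H,g)$ are Lie groups of dimension $(2n+1)+(n-t)^2+t^2$. In particular, for $0\le l\le 2n$: if $l$ is even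 or $l=n$ there are signs with $\operatorname{ind}(g)=l$ and $\dim I(H,g)=(2n+1)+n^2$; if $l$ is odd and $l\ne n$ there are signs with $\operatorname{ind}(g)=l$ and $\dim I(H,g)=(2n+1)+(n-1)^2+1$. -/

import Mathlib

open scoped ContDiff Manifold

noncomputable section

/-! ### Sub-pseudo-Riemannian structures on a vector space, and their isometries -/

section General

variable {E : Type*} [NormedAddCommGroup E] [NormedSpace ℝ E]

/-- A distribution on the manifold `E` together with a bilinear form on each of its fibres. -/
structure SubMetric (E : Type*) [NormedAddCommGroup E] [NormedSpace ℝ E] where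
  /-- the distribution -/
  H : E → Submodule ℝ E
  /-- the metric on the distribution -/
  g : (q : E) → LinearMap.BilinForm ℝ (H q)

/-- `e` is a smooth global frame of the distribution, orthonormal for the metric, and
`g (e a, e a) = ε a ∈ {1, -1}`. The existence of such a frame makes the distribution smooth of
constant rank, and the metric smooth, symmetric and nondegenerate, of index
the number of `a` with `ε a = -1`. -/
structure IsOrthonormalFrame {ι : Type*} [DecidableEq ι] (S : SubMetric E)
    (e : ι → E → E) (ε : ι → ℤˣ) : Prop where
  smooth : ∀ a, ContDiff ℝ ∞ (e a)
  linearIndependent : ∀ q, LinearIndependent ℝ (fun a => e a q)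
  span_eq : ∀ q, Submodule.span ℝ (Set.range fun a => e a q) = S.H q
  metric : ∀ (q : E) (a b : ι) (v w : S.H q), (v : E) = e a q → (w : E) = e b q →
    S.g q v w = if a = b then ((ε a : ℤ) : ℝ) else 0

/-- The index of a metric with an orthonormal frame of signs `ε`: the number of minus signs. -/
def signIndex {ι : Type*} [Fintype ι] (ε : ι → ℤˣ) : ℕ :=
  (Finset.univ.filter fun a => ε a = -1).card

/-- The exterior derivative of a one-form, as a function of two tangent vectors. -/
def dOneForm (α : E → E →L[ℝ] ℝ) (q v w : E) : ℝ :=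
  extDeriv (fun x => ContinuousAlternatingMap.ofSubsingleton ℝ E ℝ (0 : Fin 1) (α x)) q ![v, w]

/-- `α` is a smooth contact form with kernel the distribution `H` (so `dα` is nondegenerate on
`H = ker α`), normalised so that `|(dα)^n / n!| = 1` on the orthonormal frame `e` of `H`.
The square of the value of `(dα)^n / n!` on the frame, a Pfaffian, is the determinant of the
matrix of `dα` in this frame. -/
structure IsNormalizedContactForm {ι : Type*} [Fintype ι] [DecidableEq ι] (S : SubMetric E)
    (e : ι → E → E) (α : E → E →L[ℝ] ℝ) : Prop where
  smooth : ContDiff ℝ ∞ α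
  ne_zero : ∀ q, α q ≠ 0
  ker_eq : ∀ q v, v ∈ S.H q ↔ α q v = 0
  nondegenerate : ∀ q, ∀ v ∈ S.H q, (∀ w ∈ S.H q, dOneForm α q v w = 0) → v = 0
  normalized : ∀ q, (Matrix.of fun a b : ι => dOneForm α q (e a q) (e b q)).det = 1

/-- The distribution framed by `e` generates the tangent bundle with first brackets. -/
def IsBracketGenerating {ι : Type*} (e : ι → E → E) : Prop :=
  ∀ q, Submodule.span ℝ ((Set.range fun a => e a q) ∪
    Set.range fun ab : ι × ι => VectorField.lieBracket ℝ (e ab.1) (e ab.2) q) = ⊤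

/-- A diffeomorphism preserving the distribution and acting on it by linear isometries. -/
structure IsSubIsometry (S : SubMetric E) (f : E ≃ₜ E) : Prop where
  smooth : ContDiff ℝ ∞ f
  smooth_symm : ContDiff ℝ ∞ f.symm
  map_H : ∀ q, (S.H q).map (fderiv ℝ f q : E →ₗ[ℝ] E) = S.H (f q)
  map_g : ∀ (q : E) (v w : S.H q) (v' w' : S.H (f q)),
    (v' : E) = fderiv ℝ f q v → (w' : E) = fderiv ℝ f q w → S.g (f q) v' w' = S.g q v w

/-- `f` preserves the orientation of the manifold `E` and the orientation of the distribution
given by the global frame `e`: both the differential of `f` and the matrix of the differential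
relative to the frames at `q` and at `f q` have positive determinant. -/
structure PreservesOrientations {ι : Type*} [Fintype ι] [DecidableEq ι]
    (e : ι → E → E) (f : E ≃ₜ E) : Prop where
  tangent : ∀ q, 0 < (fderiv ℝ f q).det
  distribution : ∀ q, ∃ A : Matrix ι ι ℝ, 0 < A.det ∧
    ∀ a, fderiv ℝ f q (e a q) = ∑ b, A b a • e b (f q)

lemma fderiv_homeo_mul {f h : E ≃ₜ E} (hf : ContDiff ℝ ∞ f) (hh : ContDiff ℝ ∞ h) (q : E) :
    fderiv ℝ (f * h : E ≃ₜ E) q = (fderiv ℝ f (h q)).comp (fderiv ℝ h q) :=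
  fderiv_comp q (hf.differentiable (by simp) _) (hh.differentiable (by simp) _)

lemma fderiv_homeo_symm_comp {f : E ≃ₜ E} (hf : ContDiff ℝ ∞ f) (hf' : ContDiff ℝ ∞ f.symm)
    (p : E) : (fderiv ℝ f.symm (f p)).comp (fderiv ℝ f p) = ContinuousLinearMap.id ℝ E := by
  rw [← fderiv_comp p (hf'.differentiable (by simp) _) (hf.differentiable (by simp) _)]
  have : (f.symm ∘ f : E → E) = id := by ext x; simp
  rw [this, fderiv_id]

lemma IsSubIsometry.one (S : SubMetric E) : IsSubIsometry S 1 := by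
  have h1 : ((1 : E ≃ₜ E) : E → E) = id := rfl
  refine ⟨contDiff_id, contDiff_id, fun q => ?_, fun q v w v' w' hv hw => ?_⟩
  · rw [h1, fderiv_id]; exact Submodule.map_id _
  · change S.H q at v' w'
    have h2 : fderiv ℝ ((1 : E ≃ₜ E) : E → E) q = ContinuousLinearMap.id ℝ E := by
      rw [h1, fderiv_id]
    have e1 : v' = v := Subtype.ext (hv.trans (DFunLike.congr_fun h2 _))
    have e2 : w' = w := Subtype.ext (hw.trans (DFunLike.congr_fun h2 _))
    rw [e1, e2]; rfl

lemma IsSubIsometry.mul {S : SubMetric E} {f h : E ≃ₜ E} (hf : IsSubIsometry S f)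
    (hh : IsSubIsometry S h) : IsSubIsometry S (f * h) := by
  have hd := fderiv_homeo_mul hf.smooth hh.smooth
  have hm : ∀ q (v : S.H q), fderiv ℝ h q v ∈ S.H (h q) := fun q v => by
    rw [← hh.map_H q]; exact Submodule.mem_map_of_mem v.2
  refine ⟨hf.smooth.comp hh.smooth, hh.smooth_symm.comp hf.smooth_symm, fun q => ?_,
    fun q v w v' w' hv hw => ?_⟩
  · rw [hd q]
    change _ = S.H (f (h q))
    rw [← hf.map_H, ← hh.map_H, ← Submodule.map_comp]; rfl
  · rw [hd q] at hv hw
    exact (hf.map_g (h q) ⟨_, hm q v⟩ ⟨_, hm q w⟩ v' w' hv hw).trans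
      (hh.map_g q v w _ _ rfl rfl)

lemma IsSubIsometry.inv {S : SubMetric E} {f : E ≃ₜ E} (hf : IsSubIsometry S f) :
    IsSubIsometry S f⁻¹ := by
  have key : ∀ p x, fderiv ℝ f.symm (f p) (fderiv ℝ f p x) = x := fun p x =>
    DFunLike.congr_fun (fderiv_homeo_symm_comp hf.smooth hf.smooth_symm p) x
  refine ⟨hf.smooth_symm, hf.smooth, fun q => ?_, fun q v w v' w' hv hw => ?_⟩
  · obtain ⟨p, rfl⟩ := f.surjective q
    change Submodule.map (fderiv ℝ f.symm (f p) : E →ₗ[ℝ] E) _ = S.H (f.symm (f p))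
    rw [← hf.map_H p, ← Submodule.map_comp, f.symm_apply_apply]
    have : ((fderiv ℝ f.symm (f p) : E →ₗ[ℝ] E) ∘ₗ (fderiv ℝ f p : E →ₗ[ℝ] E)) =
        LinearMap.id := by
      ext x; exact key p x
    rw [this, Submodule.map_id]
  · obtain ⟨p, rfl⟩ := f.surjective q
    change (v' : E) = fderiv ℝ f.symm (f p) v at hv
    change (w' : E) = fderiv ℝ f.symm (f p) w at hw
    change S.H (f.symm (f p)) at v' w'
    change S.g (f.symm (f p)) v' w' = _
    have aux : ∀ (p' : E), p' = p → ∀ v' w' : S.H p',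
        (v' : E) = fderiv ℝ f.symm (f p) v → (w' : E) = fderiv ℝ f.symm (f p) w →
        S.g p' v' w' = S.g (f p) v w := by
      rintro p' rfl v' w' hv hw
      refine (hf.map_g p' v' w' v w ?_ ?_).symm
      · have h3 : (v : E) ∈ (S.H p').map (fderiv ℝ f p' : E →ₗ[ℝ] E) :=
          (hf.map_H p').symm ▸ v.2
        obtain ⟨x, -, hx⟩ := h3
        rw [hv, ← hx]; exact congrArg _ (key p' x).symm
      · have h3 : (w : E) ∈ (S.H p').map (fderiv ℝ f p' : E →ₗ[ℝ] E) :=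
          (hf.map_H p').symm ▸ w.2
        obtain ⟨x, -, hx⟩ := h3
        rw [hw, ← hx]; exact congrArg _ (key p' x).symm
    exact aux _ (f.symm_apply_apply p) v' w' hv hw

/-- The group of all isometries. -/
def isometryGroup (S : SubMetric E) : Subgroup (E ≃ₜ E) where
  carrier := {f | IsSubIsometry S f}
  one_mem' := IsSubIsometry.one S
  mul_mem' := IsSubIsometry.mul
  inv_mem' := IsSubIsometry.inv

/-- The group of the isometries that preserve the orientations of the manifold and of the
distribution, the latter being oriented by the frame `e`. -/
def orientedIsometryGroup {ι : Type*} [Fintype ι] [DecidableEq ι] (S : SubMetric E)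
    (e : ι → E → E) : Subgroup (E ≃ₜ E) where
  carrier := {f | IsSubIsometry S f ∧ PreservesOrientations e f}
  one_mem' := by
    have h1 : ((1 : E ≃ₜ E) : E → E) = id := rfl
    refine ⟨IsSubIsometry.one S, fun q => ?_, fun q => ⟨1, by simp, fun a => ?_⟩⟩
    · rw [h1, fderiv_id]
      change 0 < LinearMap.det (LinearMap.id : E →ₗ[ℝ] E)
      simp
    · rw [h1, fderiv_id]
      simp [Matrix.one_apply]
  mul_mem' := by
    rintro f h ⟨hf, hf'⟩ ⟨hh, hh'⟩
    have hd := fderiv_homeo_mul hf.smooth hh.smooth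
    refine ⟨hf.mul hh, fun q => ?_, fun q => ?_⟩
    · rw [hd q]
      change 0 < LinearMap.det ((fderiv ℝ f (h q) : E →ₗ[ℝ] E) ∘ₗ (fderiv ℝ h q : E →ₗ[ℝ] E))
      rw [LinearMap.det_comp]
      exact mul_pos (hf'.tangent _) (hh'.tangent _)
    · obtain ⟨A, hA, hA'⟩ := hf'.distribution (h q)
      obtain ⟨B, hB, hB'⟩ := hh'.distribution q
      refine ⟨A * B, by rw [Matrix.det_mul]; exact mul_pos hA hB, fun a => ?_⟩
      rw [hd q]
      change fderiv ℝ f (h q) (fderiv ℝ h q (e a q)) = ∑ b, (A * B) b a • e b (f (h q))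
      rw [hB', map_sum]
      simp only [map_smul, hA', Finset.smul_sum, Matrix.mul_apply, Finset.sum_smul, smul_smul]
      rw [Finset.sum_comm]
      simp only [mul_comm]
  inv_mem' := by
    rintro f ⟨hf, hf'⟩
    have key : ∀ p x, fderiv ℝ f.symm (f p) (fderiv ℝ f p x) = x := fun p x =>
      DFunLike.congr_fun (fderiv_homeo_symm_comp hf.smooth hf.smooth_symm p) x
    refine ⟨hf.inv, fun q => ?_, fun q => ?_⟩
    · obtain ⟨p, rfl⟩ := f.surjective q
      change 0 < LinearMap.det (fderiv ℝ f.symm (f p) : E →ₗ[ℝ] E)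
      have h := congrArg (fun L : E →L[ℝ] E => LinearMap.det (L : E →ₗ[ℝ] E))
        (fderiv_homeo_symm_comp hf.smooth hf.smooth_symm p)
      change LinearMap.det ((fderiv ℝ f.symm (f p) : E →ₗ[ℝ] E) ∘ₗ
        (fderiv ℝ f p : E →ₗ[ℝ] E)) = LinearMap.det (LinearMap.id : E →ₗ[ℝ] E) at h
      rw [LinearMap.det_comp, LinearMap.det_id] at h
      have hp : 0 < LinearMap.det (fderiv ℝ f p : E →ₗ[ℝ] E) := hf'.tangent p
      exact pos_of_mul_pos_left (h ▸ one_pos) hp.le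
    · obtain ⟨p, rfl⟩ := f.surjective q
      obtain ⟨A, hA, hA'⟩ := hf'.distribution p
      have hu : IsUnit A.det := hA.ne'.isUnit
      refine ⟨A⁻¹, ?_, fun a => ?_⟩
      · rw [Matrix.det_nonsing_inv, Ring.inverse_eq_inv']; exact inv_pos.mpr hA
      · change fderiv ℝ f.symm (f p) (e a (f p)) = ∑ b, A⁻¹ b a • e b (f.symm (f p))
        rw [f.symm_apply_apply]
        have h2 : e a (f p) = fderiv ℝ f p (∑ b, A⁻¹ b a • e b p) := by
          rw [map_sum]
          simp only [map_smul, hA', Finset.smul_sum, smul_smul]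
          rw [Finset.sum_comm]
          simp only [← Finset.sum_smul]
          have : ∀ c, ∑ b, A⁻¹ b a * A c b = (1 : Matrix _ _ ℝ) c a := fun c => by
            rw [← Matrix.mul_nonsing_inv A hu, Matrix.mul_apply]
            exact Finset.sum_congr rfl fun _ _ => mul_comm _ _
          simp [this, Matrix.one_apply]
        rw [h2, key]

/-- The compact-open topology on the group of homeomorphisms. -/
instance homeoCompactOpen : TopologicalSpace (E ≃ₜ E) :=
  TopologicalSpace.induced (fun f => (f : C(E, E))) inferInstance

end General

/-- The topological group `G` is a Lie group of dimension `d`. -/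
def IsLieGroupOfDim (G : Type*) [Group G] [TopologicalSpace G] (d : ℕ) : Prop :=
  T2Space G ∧ SecondCountableTopology G ∧
    ∃ _ : ChartedSpace (EuclideanSpace ℝ (Fin d)) G,
      LieGroup (𝓘(ℝ, EuclideanSpace ℝ (Fin d))) ∞ G

/-! ### The Heisenberg group -/

/-- The vector space `ℝ^{2n}` of the vectors `(x, y)`, with `x i = v (.inl i)` and
`y i = v (.inr i)`. -/
abbrev HorVec (n : ℕ) : Type := Fin n ⊕ Fin n → ℝ

/-- The manifold `ℝ^{2n+1}` of the points `(x, y, z)`. -/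
abbrev HeisPt (n : ℕ) : Type := HorVec n × ℝ

/-- The standard symplectic form `∑ dx_i ∧ dy_i` on `ℝ^{2n}`. -/
def stdSymp {n : ℕ} (v w : HorVec n) : ℝ :=
  ∑ i, (v (.inl i) * w (.inr i) - v (.inr i) * w (.inl i))

/-- The diagonal form on `ℝ^{2n}` with signs `ε`: `ε (.inl i)` is the sign of `∂/∂x_i` and
`ε (.inr i)` that of `∂/∂y_i`. -/
def diagForm {n : ℕ} (ε : Fin n ⊕ Fin n → ℤˣ) : LinearMap.BilinForm ℝ (HorVec n) :=
  Matrix.toBilin' (Matrix.diagonal fun a => ((ε a : ℤ) : ℝ))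

/-- The Heisenberg multiplication on `ℝ^{2n+1}`. -/
def heisMul {n : ℕ} (p q : HeisPt n) : HeisPt n :=
  (p.1 + q.1,
    p.2 + q.2 + (1 / 2) * ∑ i, (p.1 (.inr i) * q.1 (.inl i) - q.1 (.inr i) * p.1 (.inl i)))

lemma heisMul_eq {n : ℕ} (p q : HeisPt n) :
    heisMul p q = (p.1 + q.1, p.2 + q.2 - (1 / 2) * stdSymp p.1 q.1) := by
  refine Prod.ext rfl ?_
  simp only [heisMul, stdSymp]
  rw [sub_eq_add_neg, ← mul_neg, ← Finset.sum_neg_distrib]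
  congr 2
  exact Finset.sum_congr rfl fun i _ => by ring

lemma stdSymp_add_left {n : ℕ} (u v w : HorVec n) :
    stdSymp (u + v) w = stdSymp u w + stdSymp v w := by
  simp only [stdSymp, Pi.add_apply, ← Finset.sum_add_distrib]
  exact Finset.sum_congr rfl fun i _ => by ring

lemma stdSymp_add_right {n : ℕ} (u v w : HorVec n) :
    stdSymp u (v + w) = stdSymp u v + stdSymp u w := by
  simp only [stdSymp, Pi.add_apply, ← Finset.sum_add_distrib]
  exact Finset.sum_congr rfl fun i _ => by ring

/-- The space `ℝ^{2n+1}` carrying the Heisenberg multiplication as its group structure. -/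
def Heis (n : ℕ) : Type := HeisPt n

instance (n : ℕ) : TopologicalSpace (Heis n) := inferInstanceAs (TopologicalSpace (HeisPt n))

/-- An element of the Heisenberg group as a point of `ℝ^{2n+1}`. -/
def Heis.toPt {n : ℕ} (p : Heis n) : HeisPt n := p

instance heisGroup (n : ℕ) : Group (Heis n) where
  mul p q := heisMul p.toPt q.toPt
  one := (0 : HeisPt n)
  inv p := -p.toPt
  mul_assoc a b c := by
    change heisMul (heisMul a.toPt b.toPt) c.toPt = heisMul a.toPt (heisMul b.toPt c.toPt)
    simp only [heisMul_eq, stdSymp_add_left, stdSymp_add_right]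
    refine Prod.ext (add_assoc _ _ _) ?_
    simp only
    ring
  one_mul a := by
    change heisMul 0 a.toPt = a.toPt
    rw [heisMul_eq]
    refine Prod.ext ?_ ?_ <;> simp [stdSymp]
  mul_one a := by
    change heisMul a.toPt 0 = a.toPt
    rw [heisMul_eq]
    refine Prod.ext ?_ ?_ <;> simp [stdSymp]
  inv_mul_cancel a := by
    change heisMul (-a.toPt) a.toPt = 0
    rw [heisMul_eq]
    refine Prod.ext ?_ ?_
    · simp
    · simp [stdSymp, mul_comm]

/-- The frame `X_i = ∂/∂x_i + (1/2) y_i ∂/∂z` (index `.inl i`) and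
`Y_i = ∂/∂y_i - (1/2) x_i ∂/∂z` (index `.inr i`). -/
def heisFrame {n : ℕ} : Fin n ⊕ Fin n → HeisPt n → HeisPt n
  | .inl i, q => (Pi.single (.inl i) 1, (1 / 2) * q.1 (.inr i))
  | .inr i, q => (Pi.single (.inr i) 1, -((1 / 2) * q.1 (.inl i)))

/-- The structure on `ℝ^{2n+1}` with `H` spanned by the frame `X_i, Y_i`, and the metric
on `H` that is diagonal in this frame with diagonal entries `ε`. -/
def heisStructure {n : ℕ} (ε : Fin n ⊕ Fin n → ℤˣ) : SubMetric (HeisPt n) where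
  H q := Submodule.span ℝ (Set.range fun a => heisFrame a q)
  g _ := (diagForm ε).comp
    (LinearMap.fst ℝ (HorVec n) ℝ ∘ₗ Submodule.subtype _)
    (LinearMap.fst ℝ (HorVec n) ℝ ∘ₗ Submodule.subtype _)

/-- The contact form `(1/2) ∑ (y_i dx_i - x_i dy_i) - dz`. -/
def heisContactForm {n : ℕ} (q : HeisPt n) : HeisPt n →L[ℝ] ℝ :=
  (1 / 2 : ℝ) • (∑ i : Fin n,
    (q.1 (.inr i) • (ContinuousLinearMap.proj (R := ℝ) (φ := fun _ : Fin n ⊕ Fin n => ℝ)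
        (.inl i)).comp (ContinuousLinearMap.fst ℝ (HorVec n) ℝ) -
      q.1 (.inl i) • (ContinuousLinearMap.proj (R := ℝ) (φ := fun _ : Fin n ⊕ Fin n => ℝ)
        (.inr i)).comp (ContinuousLinearMap.fst ℝ (HorVec n) ℝ))) -
    ContinuousLinearMap.snd ℝ (HorVec n) ℝ

/-- The group `Sp(ω)` of the linear automorphisms of `ℝ^{2n}` that preserve `ω`. -/
def spGroup (n : ℕ) : Subgroup (GL (Fin n ⊕ Fin n) ℝ) where
  carrier := {σ | ∀ v w : HorVec n, stdSymp (σ.1.mulVec v) (σ.1.mulVec w) = stdSymp v w}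
  one_mem' := fun v w => by simp
  mul_mem' := fun {σ τ} hσ hτ v w => by
    simp only [Units.val_mul, ← Matrix.mulVec_mulVec]
    rw [hσ, hτ]
  inv_mem' := fun {σ} hσ v w => by
    rw [← hσ]
    simp only [Matrix.mulVec_mulVec]
    simp

/-- The group `O(g)` of the linear automorphisms of `ℝ^{2n}` that preserve the form
with signs `ε`. -/
def oGroup {n : ℕ} (ε : Fin n ⊕ Fin n → ℤˣ) : Subgroup (GL (Fin n ⊕ Fin n) ℝ) where
  carrier := {σ | ∀ v w : HorVec n,
    diagForm ε (σ.1.mulVec v) (σ.1.mulVec w) = diagForm ε v w}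
  one_mem' := fun v w => by simp
  mul_mem' := fun {σ τ} hσ hτ v w => by
    simp only [Units.val_mul, ← Matrix.mulVec_mulVec]
    rw [hσ, hτ]
  inv_mem' := fun {σ} hσ v w => by
    rw [← hσ]
    simp only [Matrix.mulVec_mulVec]
    simp

/-- The map `f_σ (x, y, z) = (σ (x, y), z)`. -/
def fSigma {n : ℕ} (σ : GL (Fin n ⊕ Fin n) ℝ) (q : HeisPt n) : HeisPt n :=
  (σ.1.mulVec q.1, q.2)

/-- The action of `Sp(ω) ∩ O(g)` on the Heisenberg group by the automorphisms `f_σ`. -/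
def heisAction {n : ℕ} (ε : Fin n ⊕ Fin n → ℤˣ) :
    (spGroup n ⊓ oGroup ε : Subgroup (GL (Fin n ⊕ Fin n) ℝ)) →* MulAut (Heis n) where
  toFun σ :=
    { toFun := fun p => fSigma σ.1 p.toPt
      invFun := fun p => fSigma (σ⁻¹).1 p.toPt
      left_inv := fun p => by
        change fSigma (σ⁻¹).1 (fSigma σ.1 p.toPt) = p.toPt
        refine Prod.ext ?_ rfl
        simp [fSigma, Matrix.mulVec_mulVec]
      right_inv := fun p => by
        change fSigma σ.1 (fSigma (σ⁻¹).1 p.toPt) = p.toPt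
        refine Prod.ext ?_ rfl
        simp [fSigma, Matrix.mulVec_mulVec]
      map_mul' := fun p q => by
        change fSigma σ.1 (heisMul p.toPt q.toPt) =
          heisMul (fSigma σ.1 p.toPt) (fSigma σ.1 q.toPt)
        rw [heisMul_eq, heisMul_eq]
        refine Prod.ext ?_ ?_
        · simp only [fSigma, Matrix.mulVec_add]
        · simp only [fSigma]
          rw [σ.2.1] }
  map_one' := by
    ext p
    change fSigma 1 p.toPt = p.toPt
    refine Prod.ext ?_ rfl
    simp [fSigma]
  map_mul' σ τ := by
    ext p
    change fSigma (σ.1 * τ.1) p.toPt = fSigma σ.1 (fSigma τ.1 p.toPt)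
    refine Prod.ext ?_ rfl
    simp [fSigma, Matrix.mulVec_mulVec]

end

open scoped ContDiff Manifold

/-! The heart is rigidity: every isometry is affine (`IsSubIsometry.exists_affine`). An isometry `f`
preserves `H = ker α`, so `f^*α = λα`, and differentiating gives `f^*dα = λ dα + dλ ∧ α`
(`IsSubIsometry.symp_fderiv`). On `H` the differential preserves `g` and multiplies `ω` by `λ`.
Comparing determinants gives `λ^{2n} = 1`, so `λ` is a constant `c = ±1` by connectedness. With `dλ
= 0` the whole differential scales the pulled-back form `ω`, hence sends `∂_z` to a vertical vector
and induces at each point a linear isometry of the flat space `ℝ^{2n}`. The algebra behind the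
uniqueness of the Levi-Civita connection then kills the horizontal part of the second derivative. So
the horizontal part of `f` is affine, and the contact identity determines its `z`-component.

The sign `c` is decided by the orientations: the differential has determinant `c · det σ`, and its
matrix in the frames is `σ`. If both determinants are positive then `c = 1`, and conversely
symplectic maps have determinant one. This gives the bijection with the semidirect product. The
topologies agree because an affine map depends continuously on its coefficients, and these are
recovered from its values at finitely many points.

For the Lie group structure, isometries are embedded by their one-jets at the origin, where the
group law is given by smooth formulas. The Cayley transform exchanges linear isometries of a
bilinear form with skew maps, which gives a chart at the identity modelled on `ℝ^{2n+1}` times the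
Lie algebra of `Sp(ω) ∩ O(g)`; left translations move it around (`isLieGroupOfDim_of_oriented_le`).
That algebra has one free parameter for each ordered pair `(i, j)` with `t_i s_i = t_j s_j`
(`finrank_isoAlgebra`). With `t` mixed pairs of signs this is `(n - t)^2 + t^2`. -/

noncomputable section

/-! ### Lie group structures from one chart at the identity -/

section LieGroupOfChart

variable {G V E : Type*} [Group G] [TopologicalSpace G] [NormedAddCommGroup V] [NormedSpace ℝ V]
  [NormedAddCommGroup E] [NormedSpace ℝ E]

/-- A group with an inducing map to a normed space, in which multiplication and inversion are
given by smooth maps, and which has one chart at the identity that is smooth in both directions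
with respect to that map, is a Lie group. -/
theorem exists_lieGroup_of_isInducing {ι : G → V} (hι : Topology.IsInducing ι)
    {m : V → V → V} (hm : ContDiff ℝ ∞ fun p : V × V => m p.1 p.2)
    (hιm : ∀ g h, ι (g * h) = m (ι g) (ι h))
    {i : V → V} (hi : ∀ g, ContDiffAt ℝ ∞ i (ι g)) (hιi : ∀ g, ι g⁻¹ = i (ι g))
    (k : OpenPartialHomeomorph G E) (h1 : 1 ∈ k.source)
    {F : V → E} (hF : ∀ g ∈ k.source, ContDiffAt ℝ ∞ F (ι g)) (hkF : ∀ g ∈ k.source, k g = F (ι g))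
    (hk : ContDiffOn ℝ ∞ (ι ∘ k.symm) k.target) :
    ∃ _ : ChartedSpace E G, LieGroup 𝓘(ℝ, E) ∞ G := by
  have hmul : ContinuousMul G := ⟨hι.continuous_iff.2 <| by
    have : (ι ∘ fun p : G × G => p.1 * p.2) = fun p : G × G => m (ι p.1) (ι p.2) :=
      funext fun p => hιm _ _
    rw [this]
    exact hm.continuous.comp ((hι.continuous.comp continuous_fst).prodMk
      (hι.continuous.comp continuous_snd))⟩
  have hinv : Continuous fun g : G => g⁻¹ := hι.continuous_iff.2 <| by
    have : (ι ∘ fun g : G => g⁻¹) = fun g => i (ι g) := funext fun g => hιi g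
    rw [this]
    exact continuous_iff_continuousAt.2 fun g => (hi g).continuousAt.comp hι.continuous.continuousAt
  -- The atlas consists of the left translates of `k`. Each chart factors through `ι` followed by a
  -- smooth map, and each inverse chart composed with `ι` is smooth, so transition maps are smooth.
  let c : G → OpenPartialHomeomorph G E := fun g =>
    (Homeomorph.mulLeft g⁻¹).toOpenPartialHomeomorph.trans k
  have hsrc : ∀ g x, x ∈ (c g).source ↔ g⁻¹ * x ∈ k.source := fun g x => by
    simp [c]
  have hc : ∀ g x, c g x = k (g⁻¹ * x) := fun g x => rfl
  have hcs : ∀ g y, (c g).symm y = g * k.symm y := fun g y =>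
    congrArg (· * k.symm y) (inv_inv g)
  have htgt : ∀ g, (c g).target = k.target := fun g => by simp [c]
  let cs : ChartedSpace E G :=
    { atlas := Set.range c
      chartAt := c
      mem_chart_source := fun g => (hsrc g g).2 (by simpa using h1)
      chart_mem_atlas := fun g => ⟨g, rfl⟩ }
  have hcF : ∀ g x, x ∈ (c g).source → c g x = F (m (ι g⁻¹) (ι x)) := fun g x hx => by
    rw [hc, hkF _ ((hsrc g x).1 hx), hιm]
  have hm' : ∀ v, ContDiff ℝ ∞ fun w => m v w := fun v =>
    hm.comp (contDiff_const.prodMk contDiff_id)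
  have hFd : ∀ g x, x ∈ (c g).source → ContDiffAt ℝ ∞ (fun w => F (m (ι g⁻¹) w)) (ι x) :=
    fun g x hx => by
      have := hF _ ((hsrc g x).1 hx)
      rw [hιm] at this
      exact this.comp (ι x) (hm' _).contDiffAt
  have hιs : ∀ g, ContDiffOn ℝ ∞ (ι ∘ (c g).symm) (c g).target := fun g => by
    have : (ι ∘ (c g).symm) = fun y => m (ι g) ((ι ∘ k.symm) y) := funext fun y => by
      rw [Function.comp_apply, hcs, hιm]; rfl
    rw [this, htgt]
    exact (hm' _).comp_contDiffOn hk
  have hman : IsManifold 𝓘(ℝ, E) ∞ G := by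
    refine isManifold_of_contDiffOn _ _ _ ?_
    rintro _ _ ⟨g, rfl⟩ ⟨h, rfl⟩
    intro y hy
    have hy' : y ∈ (c g).target ∧ (c g).symm y ∈ (c h).source := by simpa using hy
    have h3 : ContDiffAt ℝ ∞ (ι ∘ (c g).symm) y :=
      (hιs g).contDiffAt ((c g).open_target.mem_nhds hy'.1)
    have h4 : ContDiffAt ℝ ∞ (fun y => F (m (ι h⁻¹) ((ι ∘ (c g).symm) y))) y :=
      ContDiffAt.comp (g := fun w => F (m (ι h⁻¹) w)) y (hFd h _ hy'.2) h3
    refine h4.contDiffWithinAt.congr_of_mem (fun z hz => ?_) hy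
    have hz' : z ∈ (c g).target ∧ (c g).symm z ∈ (c h).source := by simpa using hz
    exact hcF h _ hz'.2
  have hιd : ContMDiff 𝓘(ℝ, E) 𝓘(ℝ, V) ∞ ι := by
    intro g
    rw [contMDiffAt_iff]
    refine ⟨hι.continuous.continuousAt, ?_⟩
    have : ContDiffAt ℝ ∞ (ι ∘ (c g).symm) (c g g) :=
      (hιs g).contDiffAt ((c g).open_target.mem_nhds
        ((c g).map_source ((hsrc g g).2 (by simpa using h1))))
    simp only [mfld_simps, extChartAt]
    exact this.contDiffWithinAt
  -- Smoothness of a continuous map into `G` can be tested after composing with `ι`. It is stated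
  -- for a general source because it serves both `G × G` (multiplication) and `G` (inversion).
  have hto : ∀ {M B H : Type _} [NormedAddCommGroup B] [NormedSpace ℝ B] [TopologicalSpace H]
      (I : ModelWithCorners ℝ B H) [TopologicalSpace M]
      [ChartedSpace H M] (f : M → G), Continuous f →
      ContMDiff I 𝓘(ℝ, V) ∞ (ι ∘ f) → ContMDiff I 𝓘(ℝ, E) ∞ f := by
    intro M B H _ _ _ I _ _ f hf hιf x
    rw [contMDiffAt_iff_target]
    refine ⟨hf.continuousAt, ?_⟩
    have hx : f x ∈ (c (f x)).source := (hsrc _ _).2 (by simpa using h1)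
    have h4 := (hFd (f x) _ hx).contMDiffAt.comp x (hιf x)
    refine h4.congr_of_eventuallyEq ?_
    filter_upwards [hf.continuousAt.preimage_mem_nhds ((c (f x)).open_source.mem_nhds hx)] with y hy
    exact hcF _ _ hy
  refine ⟨cs, { hman with contMDiff_mul := ?_, contMDiff_inv := ?_ }⟩
  · have e : (ι ∘ fun p : G × G => p.1 * p.2) =
        (fun p : V × V => m p.1 p.2) ∘ fun p : G × G => (ι p.1, ι p.2) := funext fun p => hιm _ _
    have h5 : ContMDiff (𝓘(ℝ, E).prod 𝓘(ℝ, E)) 𝓘(ℝ, V × V) ∞ fun p : G × G => (ι p.1, ι p.2) :=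
      (hιd.comp contMDiff_fst).prodMk_space (hιd.comp contMDiff_snd)
    have h6 := hm.contMDiff.comp h5
    rw [← e] at h6
    exact hto _ _ continuous_mul h6
  · refine hto _ _ hinv fun g => ?_
    have e : (ι ∘ fun g : G => g⁻¹) = i ∘ ι := funext fun g => hιi _
    rw [e]
    exact (hi g).contMDiffAt.comp g (hιd g)

end LieGroupOfChart

/-! ### Linear algebra of the symplectic and diagonal forms -/

section LinearAlgebra

/-- Take determinants in `σᵀ M σ = c M` and cancel `det M`. -/
lemma det_sq_of_scales_bilin {ι : Type*} [Fintype ι] [DecidableEq ι] {M : Matrix ι ι ℝ}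
    (hM : M.det ≠ 0) {σ : (ι → ℝ) →ₗ[ℝ] (ι → ℝ)} {c : ℝ}
    (h : ∀ v w, Matrix.toBilin' M (σ v) (σ w) = c * Matrix.toBilin' M v w) :
    LinearMap.det σ ^ 2 = c ^ Fintype.card ι := by
  have h1 : (LinearMap.toMatrix' σ).transpose * M * LinearMap.toMatrix' σ = c • M := by
    rw [← LinearMap.BilinForm.toMatrix'_toBilin' M,
      ← LinearMap.BilinForm.toMatrix'_comp, ← map_smul]
    congr 1
    ext v w
    simp [h]
  have h2 := congrArg Matrix.det h1
  rw [Matrix.det_mul, Matrix.det_mul, Matrix.det_transpose, Matrix.det_smul,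
    LinearMap.det_toMatrix'] at h2
  apply mul_right_cancel₀ hM
  rw [← h2]
  ring

variable {n : ℕ}

/-- The standard symplectic form as a bilinear form. -/
def sympForm (n : ℕ) : LinearMap.BilinForm ℝ (HorVec n) :=
  Matrix.toBilin' (-Matrix.J (Fin n) ℝ)

lemma sympForm_apply (v w : HorVec n) : sympForm n v w = stdSymp v w := by
  rw [sympForm, Matrix.toBilin'_apply', stdSymp]
  simp only [Matrix.J, Matrix.neg_mulVec, Matrix.fromBlocks_mulVec, dotProduct, Fintype.sum_sum_type,
    Finset.sum_sub_distrib]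
  simp [Function.comp_def]
  ring

lemma det_neg_J : (-Matrix.J (Fin n) ℝ).det = 1 := by
  rw [Matrix.det_neg, SymplecticGroup.det_eq_one (SymplecticGroup.J_mem _ _)]
  simp

lemma stdSymp_swap (v w : HorVec n) : stdSymp v w = -stdSymp w v := by
  simp only [stdSymp, ← Finset.sum_neg_distrib]
  exact Finset.sum_congr rfl fun i _ => by ring

lemma stdSymp_smul_right (c : ℝ) (v w : HorVec n) : stdSymp v (c • w) = c * stdSymp v w := by
  simp [← sympForm_apply]

@[simp] lemma stdSymp_zero_left (w : HorVec n) : stdSymp 0 w = 0 := by simp [stdSymp]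

@[simp] lemma stdSymp_zero_right (w : HorVec n) : stdSymp w 0 = 0 := by simp [stdSymp]

lemma stdSymp_single_inl (v : HorVec n) (i : Fin n) :
    stdSymp v (Pi.single (.inl i) 1) = -v (.inr i) := by
  simp [stdSymp, Pi.single_apply]

lemma stdSymp_single_inr (v : HorVec n) (i : Fin n) :
    stdSymp v (Pi.single (.inr i) 1) = v (.inl i) := by
  simp [stdSymp, Pi.single_apply]

lemma stdSymp_nondegenerate {v : HorVec n} (h : ∀ w, stdSymp v w = 0) : v = 0 := by
  ext (i | i)
  · simpa [stdSymp_single_inr] using h (Pi.single (.inr i) 1)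
  · simpa [stdSymp_single_inl] using h (Pi.single (.inl i) 1)

lemma diagForm_apply (ε : Fin n ⊕ Fin n → ℤˣ) (v w : HorVec n) :
    diagForm ε v w = ∑ a, ((ε a : ℤ) : ℝ) * v a * w a := by
  rw [diagForm, Matrix.toBilin'_apply', dotProduct]
  exact Finset.sum_congr rfl fun a _ => by rw [Matrix.mulVec_diagonal]; ring

lemma diagForm_comm (ε : Fin n ⊕ Fin n → ℤˣ) (v w : HorVec n) :
    diagForm ε v w = diagForm ε w v := by
  simp only [diagForm_apply]
  exact Finset.sum_congr rfl fun a _ => by ring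

lemma diagForm_single_right (ε : Fin n ⊕ Fin n → ℤˣ) (v : HorVec n) (a : Fin n ⊕ Fin n) :
    diagForm ε v (Pi.single a 1) = ((ε a : ℤ) : ℝ) * v a := by
  rw [diagForm_apply, Finset.sum_eq_single a] <;> simp +contextual

lemma coe_sign_mul_self {ι : Type*} (ε : ι → ℤˣ) (a : ι) : ((ε a : ℤ) : ℝ) * ((ε a : ℤ) : ℝ) = 1 := by
  exact_mod_cast Int.units_coe_mul_self (ε a)

lemma coe_sign_ne_zero {ι : Type*} (ε : ι → ℤˣ) (a : ι) : ((ε a : ℤ) : ℝ) ≠ 0 :=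
  left_ne_zero_of_mul_eq_one (coe_sign_mul_self ε a)

lemma diagForm_nondegenerate (ε : Fin n ⊕ Fin n → ℤˣ) {v : HorVec n}
    (h : ∀ w, diagForm ε v w = 0) : v = 0 := by
  ext a
  simpa [diagForm_single_right, coe_sign_ne_zero] using h (Pi.single a 1)

lemma det_sq_of_isometry (ε : Fin n ⊕ Fin n → ℤˣ) {σ : HorVec n →ₗ[ℝ] HorVec n}
    (h : ∀ v w, diagForm ε (σ v) (σ w) = diagForm ε v w) : LinearMap.det σ ^ 2 = 1 := by
  have := det_sq_of_scales_bilin (M := Matrix.diagonal fun a => ((ε a : ℤ) : ℝ)) (c := 1)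
    (by rw [Matrix.det_diagonal]; exact Finset.prod_ne_zero_iff.2 fun a _ => coe_sign_ne_zero ε a)
    (σ := σ) (fun v w => by rw [one_mul]; exact h v w)
  simpa using this

/-- Both forms compute `det σ ^ 2`: the diagonal one gives `1`, the symplectic one gives `c ^ (2n)`.
Hence `(c ^ 2) ^ n = 1` with `c ^ 2 ≥ 0` and `n ≠ 0`. -/
lemma sq_eq_one_of_scales (hn : 1 ≤ n) (ε : Fin n ⊕ Fin n → ℤˣ) {σ : HorVec n →ₗ[ℝ] HorVec n}
    {c : ℝ} (h : ∀ v w, diagForm ε (σ v) (σ w) = diagForm ε v w)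
    (h' : ∀ v w, stdSymp (σ v) (σ w) = c * stdSymp v w) : c ^ 2 = 1 := by
  have h1 := det_sq_of_scales_bilin (M := -Matrix.J (Fin n) ℝ) (c := c)
    (by rw [det_neg_J]; exact one_ne_zero) (σ := σ)
    (fun v w => by simpa only [← sympForm_apply, sympForm] using h' v w)
  rw [det_sq_of_isometry ε h, Fintype.card_sum, Fintype.card_fin, ← two_mul, pow_mul] at h1
  exact (pow_eq_one_iff_of_nonneg (sq_nonneg c) (by omega)).1 h1.symm

lemma det_eq_one_of_symp {σ : HorVec n →ₗ[ℝ] HorVec n}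
    (h : ∀ v w, stdSymp (σ v) (σ w) = stdSymp v w) : LinearMap.det σ = 1 := by
  rw [← LinearMap.det_toMatrix']
  apply SymplecticGroup.det_eq_one
  rw [SymplecticGroup.mem_iff', ← neg_inj, ← Matrix.neg_mul, ← Matrix.mul_neg]
  rw [← LinearMap.BilinForm.toMatrix'_toBilin' (-Matrix.J (Fin n) ℝ),
      ← LinearMap.BilinForm.toMatrix'_comp]
  congr 1
  refine LinearMap.ext fun v => LinearMap.ext fun w => ?_
  simpa only [← sympForm_apply, sympForm, LinearMap.BilinForm.comp_apply] using h v w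

lemma surjective_of_isometry (ε : Fin n ⊕ Fin n → ℤˣ) {σ : HorVec n →ₗ[ℝ] HorVec n}
    (h : ∀ v w, diagForm ε (σ v) (σ w) = diagForm ε v w) : Function.Surjective σ := by
  refine LinearMap.injective_iff_surjective.1 ((injective_iff_map_eq_zero σ).2 fun v hv => ?_)
  exact diagForm_nondegenerate ε fun w => by rw [← h, hv]; simp

/-- The symplectic form as a continuous bilinear map. -/
def sympL (n : ℕ) : HorVec n →L[ℝ] HorVec n →L[ℝ] ℝ := (sympForm n).toContinuousBilinearMap

lemma sympL_apply (v w : HorVec n) : sympL n v w = stdSymp v w := sympForm_apply v w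

/-- The diagonal form as a continuous bilinear map. -/
def diagL (ε : Fin n ⊕ Fin n → ℤˣ) : HorVec n →L[ℝ] HorVec n →L[ℝ] ℝ :=
  (diagForm ε).toContinuousBilinearMap

lemma diagL_apply (ε : Fin n ⊕ Fin n → ℤˣ) (v w : HorVec n) : diagL ε v w = diagForm ε v w := rfl

end LinearAlgebra

/-! ### Horizontal lifts and the splitting of the tangent space -/

section Frame

variable {n : ℕ}

/-- The horizontal lift at the point `q` of a vector of `ℝ^{2n}`. -/
def horLift (q : HeisPt n) : HorVec n →ₗ[ℝ] HeisPt n :=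
  LinearMap.prod LinearMap.id (-(1 / 2 : ℝ) • sympForm n q.1)

lemma horLift_apply (q : HeisPt n) (w : HorVec n) :
    horLift q w = (w, -(1 / 2) * stdSymp q.1 w) := by
  simp [horLift, sympForm_apply]

lemma heisFrame_eq (a : Fin n ⊕ Fin n) (q : HeisPt n) :
    heisFrame a q = horLift q (Pi.single a 1) := by
  rw [horLift_apply]
  rcases a with i | i
  · rw [stdSymp_single_inl]; simp [heisFrame]
  · rw [stdSymp_single_inr]; simp [heisFrame]

/-- The negative of the contact form. -/
def vertPart (q v : HeisPt n) : ℝ := v.2 + 1 / 2 * stdSymp q.1 v.1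

/-- This is the decomposition of the tangent space into `H_q` and the line of `∂_z`. It reduces
statements about all tangent vectors to horizontal ones and `∂_z`. -/
lemma eq_horLift_add (q v : HeisPt n) : v = horLift q v.1 + vertPart q v • (0, 1) := by
  rw [horLift_apply, vertPart]
  refine Prod.ext (by simp) ?_
  simp

lemma range_horLift (ε : Fin n ⊕ Fin n → ℤˣ) (q : HeisPt n) :
    (heisStructure ε).H q = LinearMap.range (horLift q) := by
  change Submodule.span ℝ (Set.range fun a => heisFrame a q) = _
  simp only [heisFrame_eq]
  rw [LinearMap.range_eq_map, ← (Pi.basisFun ℝ (Fin n ⊕ Fin n)).span_eq, Submodule.map_span,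
    ← Set.range_comp]
  congr 2
  ext1 a
  simp

lemma mem_H_iff (ε : Fin n ⊕ Fin n → ℤˣ) (q v : HeisPt n) :
    v ∈ (heisStructure ε).H q ↔ vertPart q v = 0 := by
  rw [range_horLift]
  constructor
  · rintro ⟨w, rfl⟩
    rw [horLift_apply, vertPart]
    ring
  · intro h
    exact ⟨v.1, by conv_rhs => rw [eq_horLift_add q v, h, zero_smul, add_zero]⟩

lemma horLift_mem_H (ε : Fin n ⊕ Fin n → ℤˣ) (q : HeisPt n) (w : HorVec n) :
    horLift q w ∈ (heisStructure ε).H q := by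
  rw [range_horLift]; exact LinearMap.mem_range_self _ _

lemma heisStructure_g_apply (ε : Fin n ⊕ Fin n → ℤˣ) (q : HeisPt n) (v w : (heisStructure ε).H q) :
    (heisStructure ε).g q v w = diagForm ε (v : HeisPt n).1 (w : HeisPt n).1 := rfl

lemma vertPart_add (q v w : HeisPt n) : vertPart q (v + w) = vertPart q v + vertPart q w := by
  simp only [vertPart, Prod.fst_add, Prod.snd_add, stdSymp_add_right]; ring

lemma vertPart_smul (c : ℝ) (q v : HeisPt n) : vertPart q (c • v) = c * vertPart q v := by
  simp only [vertPart, Prod.smul_fst, Prod.smul_snd, stdSymp_smul_right, smul_eq_mul]; ring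

end Frame

/-! ### Rigidity of isometries -/

section Rigidity

variable {n : ℕ} {ε : Fin n ⊕ Fin n → ℤˣ} {f : HeisPt n ≃ₜ HeisPt n}

/-- The factor by which a contactomorphism rescales the contact form. -/
def contactScale (f : HeisPt n ≃ₜ HeisPt n) (q : HeisPt n) : ℝ :=
  vertPart (f q) (fderiv ℝ f q (0, 1))

lemma IsSubIsometry.fderiv_mem (hf : IsSubIsometry (heisStructure ε) f) {q v : HeisPt n}
    (hv : v ∈ (heisStructure ε).H q) : fderiv ℝ f q v ∈ (heisStructure ε).H (f q) := by
  rw [← hf.map_H q]; exact Submodule.mem_map_of_mem hv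

/-- This is `f^*α = λα`: both sides vanish on `H`, and they agree on `∂_z` by the definition of `λ`.
-/
lemma IsSubIsometry.vertPart_fderiv (hf : IsSubIsometry (heisStructure ε) f) (q v : HeisPt n) :
    vertPart (f q) (fderiv ℝ f q v) = contactScale f q * vertPart q v := by
  have h := (mem_H_iff ε _ _).1 (hf.fderiv_mem (horLift_mem_H ε q v.1))
  conv_lhs => rw [eq_horLift_add q v, map_add, map_smul, vertPart_add, vertPart_smul, h, zero_add]
  rw [contactScale, mul_comm]

lemma IsSubIsometry.diagForm_fderiv (hf : IsSubIsometry (heisStructure ε) f) (q : HeisPt n)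
    {v w : HeisPt n} (hv : v ∈ (heisStructure ε).H q) (hw : w ∈ (heisStructure ε).H q) :
    diagForm ε (fderiv ℝ f q v).1 (fderiv ℝ f q w).1 = diagForm ε v.1 w.1 :=
  hf.map_g q ⟨v, hv⟩ ⟨w, hw⟩ ⟨_, hf.fderiv_mem hv⟩ ⟨_, hf.fderiv_mem hw⟩ rfl rfl

lemma hasFDerivAt_fderiv_apply {E F : Type*} [NormedAddCommGroup E] [NormedSpace ℝ E]
    [NormedAddCommGroup F] [NormedSpace ℝ F] {f : E → F} (hf : ContDiff ℝ ∞ f) (q v : E) :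
    HasFDerivAt (fun x => fderiv ℝ f x v) ((fderiv ℝ (fderiv ℝ f) q).flip v) q := by
  have h : HasFDerivAt (fderiv ℝ f) (fderiv ℝ (fderiv ℝ f) q) q :=
    ((hf.fderiv_right (m := 1) (by norm_cast)).differentiable (by simp) q).hasFDerivAt
  exact (h.clm_apply (hasFDerivAt_const v q)).congr_fderiv (by ext; simp)

lemma contDiff_contactScale (hf : ContDiff ℝ ∞ f) : ContDiff ℝ 1 (contactScale f) := by
  have h1 : ContDiff ℝ 1 fun q => fderiv ℝ f q (0, 1) :=
    (hf.fderiv_right (m := 1) (by norm_cast)).clm_apply contDiff_const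
  have h2 : ContDiff ℝ 1 f := hf.of_le (by norm_cast)
  have h3 : contactScale f = fun q => (fderiv ℝ f q (0, 1)).2 +
      1 / 2 * sympL n (f q).1 (fderiv ℝ f q (0, 1)).1 :=
    funext fun q => by rw [sympL_apply]; rfl
  rw [h3]
  exact h1.snd.add (contDiff_const.mul
    (((sympL n).contDiff.comp h2.fst).clm_apply h1.fst))

/-- The exterior derivative of `f^*α = λα`, namely `f^*dα = λ dα + dλ ∧ α`, evaluated on two
arbitrary tangent vectors. -/
lemma IsSubIsometry.symp_fderiv (hf : IsSubIsometry (heisStructure ε) f) (q u v : HeisPt n) :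
    stdSymp (fderiv ℝ f q u).1 (fderiv ℝ f q v).1 = contactScale f q * stdSymp u.1 v.1 +
      fderiv ℝ (contactScale f) q u * vertPart q v -
      fderiv ℝ (contactScale f) q v * vertPart q u := by
  have hs : HasFDerivAt (contactScale f) (fderiv ℝ (contactScale f) q) q :=
    ((contDiff_contactScale hf.smooth).differentiable (by simp) q).hasFDerivAt
  have hfd : HasFDerivAt f (fderiv ℝ f q) q :=
    (hf.smooth.differentiable (by simp) q).hasFDerivAt
  -- Differentiate the contact identity for the fixed vector `v` in the direction `u`. The second
  -- derivatives of `f` are symmetric in `u` and `v`, so they disappear from the antisymmetrization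
  -- that ends the proof.
  have key : ∀ u v : HeisPt n,
      (fderiv ℝ (fderiv ℝ f) q u v).2 + 1 / 2 * (stdSymp (f q).1 (fderiv ℝ (fderiv ℝ f) q u v).1 +
        stdSymp (fderiv ℝ f q u).1 (fderiv ℝ f q v).1) =
      contactScale f q * (1 / 2 * stdSymp u.1 v.1) +
        fderiv ℝ (contactScale f) q u * vertPart q v := by
    intro u v
    have h1 := hasFDerivAt_fderiv_apply hf.smooth q v
    have h2 := h1.snd.add
      (((sympL n).hasFDerivAt_of_bilinear hfd.fst h1.fst).const_mul (1 / 2 : ℝ))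
    have h3 := hs.mul ((hasFDerivAt_const v.2 q).add
      ((((sympL n).hasFDerivAt_of_bilinear (hasFDerivAt_id q).fst
        (hasFDerivAt_const v.1 q)).const_mul (1 / 2 : ℝ))))
    have h4 : (fun x => vertPart (f x) (fderiv ℝ f x v)) =
        fun x => contactScale f x * vertPart x v := funext fun x => hf.vertPart_fderiv x v
    have h5 := h2.unique (h3.congr_of_eventuallyEq (Filter.Eventually.of_forall fun x => ?_))
    · have h6 := DFunLike.congr_fun h5 u
      simp [sympL_apply] at h6
      rw [vertPart]
      simp only [one_div]
      linear_combination h6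
    · have := congrFun h4 x
      simpa [vertPart, ← sympL_apply] using this
  have e := hf.smooth.contDiffAt.isSymmSndFDerivAt (x := q)
    (by rw [minSmoothness_of_isRCLikeNormedField]; norm_cast) u v
  have k1 := key u v
  have k2 := key v u
  rw [← e, stdSymp_swap (fderiv ℝ f q v).1, stdSymp_swap v.1] at k2
  linear_combination k1 - k2

/-- The horizontal part of the differential, as an endomorphism of `ℝ^{2n}`. -/
def horFDeriv (f : HeisPt n ≃ₜ HeisPt n) (q : HeisPt n) : HorVec n →ₗ[ℝ] HorVec n :=
  LinearMap.fst ℝ (HorVec n) ℝ ∘ₗ (fderiv ℝ f q : HeisPt n →ₗ[ℝ] HeisPt n) ∘ₗ horLift q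

lemma horFDeriv_apply (q : HeisPt n) (w : HorVec n) :
    horFDeriv f q w = (fderiv ℝ f q (horLift q w)).1 := rfl

lemma IsSubIsometry.horFDeriv_isometry (hf : IsSubIsometry (heisStructure ε) f) (q : HeisPt n)
    (v w : HorVec n) : diagForm ε (horFDeriv f q v) (horFDeriv f q w) = diagForm ε v w := by
  rw [horFDeriv_apply, horFDeriv_apply,
    hf.diagForm_fderiv q (horLift_mem_H ε q v) (horLift_mem_H ε q w)]
  rfl

lemma IsSubIsometry.horFDeriv_symp (hf : IsSubIsometry (heisStructure ε) f) (q : HeisPt n)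
    (v w : HorVec n) :
    stdSymp (horFDeriv f q v) (horFDeriv f q w) = contactScale f q * stdSymp v w := by
  rw [horFDeriv_apply, horFDeriv_apply, hf.symp_fderiv,
    (mem_H_iff ε _ _).1 (horLift_mem_H ε q v), (mem_H_iff ε _ _).1 (horLift_mem_H ε q w)]
  simp [horLift_apply]

/-- A continuous function with square one on a connected space is constant. -/
lemma IsSubIsometry.exists_contactScale (hn : 1 ≤ n) (hf : IsSubIsometry (heisStructure ε) f) :
    ∃ c : ℝ, (c = 1 ∨ c = -1) ∧ ∀ q, contactScale f q = c := by
  have h := isPreconnected_univ.eq_one_or_eq_neg_one_of_sq_eq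
    (contDiff_contactScale hf.smooth).continuous.continuousOn
    (fun q _ => sq_eq_one_of_scales hn ε (hf.horFDeriv_isometry q) (hf.horFDeriv_symp q))
  rcases h with h | h
  · exact ⟨1, .inl rfl, fun q => h (Set.mem_univ q)⟩
  · exact ⟨-1, .inr rfl, fun q => h (Set.mem_univ q)⟩

/-- Every isometry is the composition of a left translation with a linear map that scales the
symplectic form by a sign and preserves the diagonal form. -/
theorem IsSubIsometry.exists_affine (hn : 1 ≤ n) (hf : IsSubIsometry (heisStructure ε) f) :
    ∃ (σ : HorVec n →L[ℝ] HorVec n) (c : ℝ), (c = 1 ∨ c = -1) ∧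
      (∀ v w, stdSymp (σ v) (σ w) = c * stdSymp v w) ∧
      (∀ v w, diagForm ε (σ v) (σ w) = diagForm ε v w) ∧
      ∀ q, f q = heisMul (f 0) (σ q.1, c * q.2) := by
  obtain ⟨c, hc, hcq⟩ := hf.exists_contactScale hn
  have hfd : ∀ q, HasFDerivAt f (fderiv ℝ f q) q := fun q =>
    (hf.smooth.differentiable (by simp) q).hasFDerivAt
  have hsymp : ∀ q u v : HeisPt n,
      stdSymp (fderiv ℝ f q u).1 (fderiv ℝ f q v).1 = c * stdSymp u.1 v.1 := fun q u v => by
    rw [hf.symp_fderiv, (funext hcq : contactScale f = fun _ => c)]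
    simp
  have hsurj : ∀ q, Function.Surjective (horFDeriv f q) := fun q =>
    surjective_of_isometry ε (hf.horFDeriv_isometry q)
  -- Since `dλ = 0`, the image of `∂_z` is `ω`-orthogonal to the horizontal parts of the images of
  -- all horizontal vectors, which fill `ℝ^{2n}`.
  have hvert : ∀ q, (fderiv ℝ f q (0, 1)).1 = 0 := fun q =>
    stdSymp_nondegenerate fun w => by
      obtain ⟨w, rfl⟩ := hsurj q w
      rw [horFDeriv_apply, hsymp]
      simp
  have hhor : ∀ q v : HeisPt n, (fderiv ℝ f q v).1 = horFDeriv f q v.1 := fun q v => by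
    conv_lhs => rw [eq_horLift_add q v, map_add, map_smul]
    simp [hvert, horFDeriv_apply]
  have hdiag : ∀ q u v : HeisPt n,
      diagForm ε (fderiv ℝ f q u).1 (fderiv ℝ f q v).1 = diagForm ε u.1 v.1 := fun q u v => by
    rw [hhor, hhor, hf.horFDeriv_isometry]
  -- The trilinear form `g(D²f(w, u), Df v)` is symmetric in `w, u` and, by differentiating the
  -- invariance of `g`, antisymmetric in `u, v`. Such a form vanishes, as in the uniqueness proof of
  -- the Levi-Civita connection.
  have hsnd : ∀ q w u : HeisPt n, (fderiv ℝ (fderiv ℝ f) q w u).1 = 0 := by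
    intro q
    have hanti : ∀ w u v : HeisPt n,
        diagForm ε (fderiv ℝ (fderiv ℝ f) q w u).1 (fderiv ℝ f q v).1 =
        -diagForm ε (fderiv ℝ (fderiv ℝ f) q w v).1 (fderiv ℝ f q u).1 := by
      intro w u v
      have h1 := (diagL ε).hasFDerivAt_of_bilinear (hasFDerivAt_fderiv_apply hf.smooth q u).fst
        (hasFDerivAt_fderiv_apply hf.smooth q v).fst
      have h2 : (fun x => diagL ε (fderiv ℝ f x u).1 (fderiv ℝ f x v).1) =
          fun _ => diagForm ε u.1 v.1 := funext fun x => hdiag x u v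
      rw [h2] at h1
      have h3 := DFunLike.congr_fun (h1.unique (hasFDerivAt_const _ q)) w
      simp [diagL_apply] at h3
      rw [diagForm_comm ε (fderiv ℝ (fderiv ℝ f) q w v).1]
      linarith
    have hsym : ∀ w u, fderiv ℝ (fderiv ℝ f) q w u = fderiv ℝ (fderiv ℝ f) q u w := fun w u =>
      hf.smooth.contDiffAt.isSymmSndFDerivAt (x := q)
        (by rw [minSmoothness_of_isRCLikeNormedField]; norm_cast) w u
    intro w u
    refine diagForm_nondegenerate ε fun v => ?_
    obtain ⟨v, rfl⟩ := hsurj q v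
    rw [horFDeriv_apply]
    generalize horLift q v = v
    have e1 := hanti w u v
    have e2 := hanti v w u
    have e3 := hanti u v w
    rw [hsym v w] at e2
    rw [hsym u v] at e3
    rw [hsym u w] at e3
    linarith
  let σ : HorVec n →L[ℝ] HorVec n := (ContinuousLinearMap.fst ℝ (HorVec n) ℝ).comp
    ((fderiv ℝ f 0).comp (ContinuousLinearMap.inl ℝ (HorVec n) ℝ))
  have hσ : ∀ q v : HeisPt n, (fderiv ℝ f q v).1 = σ v.1 := by
    intro q v
    have h1 : ∀ x, HasFDerivAt (fun x => (fderiv ℝ f x v).1)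
        (0 : HeisPt n →L[ℝ] HorVec n) x := fun x =>
      (hasFDerivAt_fderiv_apply hf.smooth x v).fst.congr_fderiv (by
        exact ContinuousLinearMap.ext fun w => hsnd x w v)
    have h2 := is_const_of_fderiv_eq_zero (fun x => (h1 x).differentiableAt)
      (fun x => (h1 x).fderiv) q 0
    rw [h2, hhor, horFDeriv_apply, horLift_apply]
    simp [σ]
  have hfst : ∀ q, (f q).1 = (f 0).1 + σ q.1 := by
    intro q
    have h1 : ∀ x, HasFDerivAt (fun x => (f x).1 - σ x.1)
        (0 : HeisPt n →L[ℝ] HorVec n) x := fun x =>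
      ((hfd x).fst.sub (σ.hasFDerivAt.comp x (hasFDerivAt_id x).fst)).congr_fderiv (by
        refine ContinuousLinearMap.ext fun w => ?_
        change (fderiv ℝ f x w).1 - σ w.1 = 0
        rw [hσ, sub_self])
    have h2 := is_const_of_fderiv_eq_zero (fun x => (h1 x).differentiableAt)
      (fun x => (h1 x).fderiv) q 0
    rw [Prod.fst_zero, map_zero σ, sub_zero] at h2
    rw [← h2]; abel
  have hσs : ∀ v w, stdSymp (σ v) (σ w) = c * stdSymp v w := fun v w => by
    rw [← hσ 0 (v, 0), ← hσ 0 (w, 0), hsymp]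
  -- The contact identity expresses the `z`-component of the differential through the horizontal
  -- part, which is already known; the terms involving `q` cancel.
  have hsnd' : ∀ q v : HeisPt n, (fderiv ℝ f q v).2 = c * v.2 - 1 / 2 * stdSymp (f 0).1 (σ v.1) := by
    intro q v
    have := hf.vertPart_fderiv q v
    rw [hcq, vertPart, vertPart, hσ, hfst, stdSymp_add_left, hσs] at this
    linear_combination this
  refine ⟨σ, c, hc, hσs, fun v w => ?_, fun q => ?_⟩
  · rw [← hσ 0 (v, 0), ← hσ 0 (w, 0), hdiag]
  · have h1 : ∀ x, HasFDerivAt (fun x => (f x).2 - (c * x.2 - 1 / 2 * sympL n (f 0).1 (σ x.1)))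
        (0 : HeisPt n →L[ℝ] ℝ) x := fun x =>
      ((hfd x).snd.sub (((hasFDerivAt_id x).snd.const_mul c).sub
        ((((sympL n (f 0).1).comp σ).hasFDerivAt.comp x (hasFDerivAt_id x).fst).const_mul
          (1 / 2 : ℝ)))).congr_fderiv (by
        refine ContinuousLinearMap.ext fun w => ?_
        change (fderiv ℝ f x w).2 - (c * w.2 - 1 / 2 * sympL n (f 0).1 (σ w.1)) = 0
        rw [hsnd', sympL_apply, sub_self])
    have h2 := is_const_of_fderiv_eq_zero (fun x => (h1 x).differentiableAt)
      (fun x => (h1 x).fderiv) q 0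
    simp only [sympL_apply, Prod.fst_zero, Prod.snd_zero, map_zero] at h2
    rw [heisMul_eq]
    refine Prod.ext (hfst q) ?_
    linear_combination h2

end Rigidity

/-! ### Lie group structures from a parametrization near the identity -/

section LieGroupOfParametrization

variable {G V E : Type*} [Group G] [TopologicalSpace G] [NormedAddCommGroup V] [NormedSpace ℝ V]
  [NormedAddCommGroup E] [NormedSpace ℝ E]

/-- Variant of `exists_lieGroup_of_isInducing`, in which the chart at the identity is given by a
smooth map `F` on the ambient space and a smooth parametrization `S` on an open set `T`. -/
theorem exists_lieGroup_of_parametrization {ι : G → V} (hι : Topology.IsInducing ι)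
    (hinj : Function.Injective ι)
    {m : V → V → V} (hm : ContDiff ℝ ∞ fun p : V × V => m p.1 p.2)
    (hιm : ∀ g h, ι (g * h) = m (ι g) (ι h))
    {i : V → V} (hi : ∀ g, ContDiffAt ℝ ∞ i (ι g)) (hιi : ∀ g, ι g⁻¹ = i (ι g))
    {U : Set G} (hU : IsOpen U) (h1 : 1 ∈ U) {T : Set E} (hT : IsOpen T)
    {F : V → E} (hF : ∀ g ∈ U, ContDiffAt ℝ ∞ F (ι g)) {S : E → V} (hS : ContDiffOn ℝ ∞ S T)
    (hST : ∀ y ∈ T, ∃ g ∈ U, ι g = S y) (hFT : ∀ g ∈ U, F (ι g) ∈ T)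
    (hSF : ∀ g ∈ U, S (F (ι g)) = ι g) (hFS : ∀ y ∈ T, F (S y) = y) :
    ∃ _ : ChartedSpace E G, LieGroup 𝓘(ℝ, E) ∞ G := by
  classical
  choose! s hsU hs using hST
  have hsS : Set.EqOn (ι ∘ s) S T := fun y hy => hs y hy
  let k : OpenPartialHomeomorph G E :=
    { toFun := fun g => F (ι g)
      invFun := s
      source := U
      target := T
      map_source' := hFT
      map_target' := hsU
      left_inv' := fun g hg => hinj ((hs _ (hFT g hg)).trans (hSF g hg))
      right_inv' := fun y hy => by rw [hs y hy, hFS y hy]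
      open_source := hU
      open_target := hT
      continuousOn_toFun := fun g hg =>
        ((hF g hg).continuousAt.comp hι.continuous.continuousAt).continuousWithinAt
      continuousOn_invFun := hι.continuousOn_iff.2 (hS.continuousOn.congr hsS) }
  exact exists_lieGroup_of_isInducing hι hm hιm hi hιi k h1 (F := F) hF (fun g _ => rfl)
    (hS.congr hsS)

end LieGroupOfParametrization

/-! ### The affine isometries and their orientation behaviour -/

section AffineIsometries

variable {n : ℕ}

/-- The differential of `q ↦ p * (σ (x, y), c z)`. -/
def affL (p : HeisPt n) (σ : HorVec n →L[ℝ] HorVec n) (c : ℝ) : HeisPt n →L[ℝ] HeisPt n :=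
  (σ.comp (ContinuousLinearMap.fst ℝ (HorVec n) ℝ)).prod
    (c • ContinuousLinearMap.snd ℝ (HorVec n) ℝ -
      (1 / 2 : ℝ) • ((sympL n p.1).comp (σ.comp (ContinuousLinearMap.fst ℝ (HorVec n) ℝ))))

lemma affL_apply (p : HeisPt n) (σ : HorVec n →L[ℝ] HorVec n) (c : ℝ) (q : HeisPt n) :
    affL p σ c q = (σ q.1, c * q.2 - 1 / 2 * stdSymp p.1 (σ q.1)) := by
  simp [affL, sympL_apply]

lemma heisMul_eq_affL (p : HeisPt n) (σ : HorVec n →L[ℝ] HorVec n) (c : ℝ) (q : HeisPt n) :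
    heisMul p (σ q.1, c * q.2) = p + affL p σ c q := by
  rw [heisMul_eq, affL_apply]
  refine Prod.ext rfl ?_
  simp only [Prod.snd_add]
  ring

/-- The map is the block-diagonal map with blocks `σ` and `c`, followed by a transvection along the
`z`-axis, which has determinant one because its functional vanishes on that axis. -/
lemma det_affL (p : HeisPt n) (σ : HorVec n →L[ℝ] HorVec n) (c : ℝ) :
    (affL p σ c).det = LinearMap.det (σ : HorVec n →ₗ[ℝ] HorVec n) * c := by
  have h : (affL p σ c : HeisPt n →ₗ[ℝ] HeisPt n) =
      LinearMap.transvection (-(1 / 2 : ℝ) • (sympForm n p.1 ∘ₗ LinearMap.fst ℝ (HorVec n) ℝ))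
        (0, 1) ∘ₗ LinearMap.prodMap (σ : HorVec n →ₗ[ℝ] HorVec n) (c • LinearMap.id) := by
    refine LinearMap.ext fun q => ?_
    change affL p σ c q = _
    rw [affL_apply]
    refine Prod.ext ?_ ?_ <;> simp [LinearMap.transvection.apply, sympForm_apply]
    ring
  rw [ContinuousLinearMap.det, h, LinearMap.det_comp, LinearMap.transvection.det,
    LinearMap.det_prodMap]
  simp

/-- The homeomorphism `q ↦ p * f_σ q`. -/
def heisHomeo (p : HeisPt n) (σ : GL (Fin n ⊕ Fin n) ℝ) : HeisPt n ≃ₜ HeisPt n where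
  toFun q := p + affL p (Matrix.toLin' σ.1).toContinuousLinearMap 1 q
  invFun q := (σ⁻¹.1.mulVec (q.1 - p.1), q.2 - p.2 + 1 / 2 * stdSymp p.1 (q.1 - p.1))
  left_inv q := by
    simp only [affL_apply]
    refine Prod.ext ?_ ?_
    · simp [Matrix.mulVec_mulVec]
    · simp
  right_inv q := by
    simp only [affL_apply]
    refine Prod.ext ?_ ?_
    · simp [Matrix.mulVec_mulVec]
    · simp [Matrix.mulVec_mulVec]
  continuous_toFun := by fun_prop
  continuous_invFun := by
    simp only [← sympL_apply]
    refine Continuous.prodMk ?_ ?_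
    · exact (Matrix.toLin' σ⁻¹.1).continuous_of_finiteDimensional.comp
        (continuous_fst.sub continuous_const)
    · exact (continuous_snd.sub continuous_const).add (continuous_const.mul
        ((sympL n p.1).continuous.comp (continuous_fst.sub continuous_const)))

/-- A matrix as a continuous endomorphism. -/
abbrev matL (σ : GL (Fin n ⊕ Fin n) ℝ) : HorVec n →L[ℝ] HorVec n :=
  (Matrix.toLin' σ.1).toContinuousLinearMap

lemma heisHomeo_eq (p : HeisPt n) (σ : GL (Fin n ⊕ Fin n) ℝ) (q : HeisPt n) :
    heisHomeo p σ q = p + affL p (matL σ) 1 q := rfl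

lemma heisHomeo_apply (p : HeisPt n) (σ : GL (Fin n ⊕ Fin n) ℝ) (q : HeisPt n) :
    heisHomeo p σ q = heisMul p (fSigma σ q) := by
  rw [heisHomeo_eq, ← heisMul_eq_affL, one_mul]; rfl

lemma fderiv_of_eq_affL {f : HeisPt n → HeisPt n} {p : HeisPt n} {σ : HorVec n →L[ℝ] HorVec n}
    {c : ℝ} (h : ∀ q, f q = p + affL p σ c q) (q : HeisPt n) : fderiv ℝ f q = affL p σ c := by
  rw [funext h, fderiv_const_add]
  exact (affL p σ c).fderiv

/-- Left translations and the maps `f_σ` with `σ` symplectic preserve the contact form, so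
horizontal vectors stay horizontal and only their projection to `ℝ^{2n}` is transformed. -/
lemma affL_horLift {p : HeisPt n} {σ : HorVec n →L[ℝ] HorVec n}
    (hσ : ∀ v w, stdSymp (σ v) (σ w) = stdSymp v w) (q : HeisPt n) (w : HorVec n) :
    affL p σ 1 (horLift q w) = horLift (p + affL p σ 1 q) (σ w) := by
  rw [affL_apply, horLift_apply, horLift_apply, affL_apply]
  refine Prod.ext rfl ?_
  simp only [Prod.fst_add, stdSymp_add_left, hσ]
  ring

variable {ε : Fin n ⊕ Fin n → ℤˣ}

lemma isSubIsometry_heisHomeo (p : HeisPt n) {σ : GL (Fin n ⊕ Fin n) ℝ}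
    (hσ : σ ∈ spGroup n ⊓ oGroup ε) : IsSubIsometry (heisStructure ε) (heisHomeo p σ) := by
  have hd := fderiv_of_eq_affL (heisHomeo_eq p σ)
  have hs : ∀ v w, stdSymp (matL σ v) (matL σ w) = stdSymp v w := hσ.1
  have hsurj : Function.Surjective (matL σ : HorVec n →ₗ[ℝ] HorVec n) :=
    surjective_of_isometry ε (σ := (matL σ : HorVec n →ₗ[ℝ] HorVec n)) hσ.2
  refine ⟨?_, ?_, fun q => ?_, fun q v w v' w' hv hw => ?_⟩
  · exact contDiff_const.add (affL p (matL σ) 1).contDiff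
  · change ContDiff ℝ ∞ fun q : HeisPt n => ((matL σ⁻¹) (q.1 - p.1),
      q.2 - p.2 + 1 / 2 * stdSymp p.1 (q.1 - p.1))
    simp only [← sympL_apply]
    fun_prop
  · rw [hd, range_horLift, range_horLift, ← LinearMap.range_comp]
    have : (affL p (matL σ) 1 : HeisPt n →ₗ[ℝ] HeisPt n) ∘ₗ horLift q =
        horLift (heisHomeo p σ q) ∘ₗ (matL σ : HorVec n →ₗ[ℝ] HorVec n) :=
      LinearMap.ext fun w => affL_horLift hs q w
    rw [this, LinearMap.range_comp, LinearMap.range_eq_top.2 hsurj, LinearMap.range_eq_map]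
  · rw [heisStructure_g_apply, heisStructure_g_apply, hv, hw, hd, affL_apply, affL_apply]
    exact hσ.2 _ _

lemma heisHomeo_mem_oriented (p : HeisPt n) {σ : GL (Fin n ⊕ Fin n) ℝ}
    (hσ : σ ∈ spGroup n ⊓ oGroup ε) :
    heisHomeo p σ ∈ orientedIsometryGroup (heisStructure ε) heisFrame := by
  have hd := fderiv_of_eq_affL (heisHomeo_eq p σ)
  have hs : ∀ v w, stdSymp (matL σ v) (matL σ w) = stdSymp v w := hσ.1
  have hdet : LinearMap.det (matL σ : HorVec n →ₗ[ℝ] HorVec n) = 1 :=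
    det_eq_one_of_symp (σ := (matL σ : HorVec n →ₗ[ℝ] HorVec n)) hσ.1
  refine ⟨isSubIsometry_heisHomeo p hσ, fun q => ?_, fun q => ⟨σ.1, ?_, fun a => ?_⟩⟩
  · rw [hd, det_affL, hdet, one_mul]; exact one_pos
  · rw [← LinearMap.det_toLin']
    exact hdet ▸ one_pos
  · simp only [heisFrame_eq]
    rw [hd, affL_horLift hs, ← heisHomeo_eq]
    simp only [← map_smul, ← map_sum]
    congr 1
    ext b
    simp [Finset.sum_apply, Pi.single_apply]

/-- The matrix of the differential in the frames is that of `σ`, so orientation of `H` gives `det σ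
> 0`; orientation of the whole space gives `c · det σ > 0`. -/
lemma scale_eq_one_of_oriented {f : HeisPt n ≃ₜ HeisPt n} (hf : PreservesOrientations heisFrame f)
    {p : HeisPt n} {σ : HorVec n →L[ℝ] HorVec n} {c : ℝ} (hc : c = 1 ∨ c = -1)
    (h : ∀ q, f q = p + affL p σ c q) : c = 1 := by
  have hd := fderiv_of_eq_affL h
  obtain ⟨A, hA, hA'⟩ := hf.distribution 0
  have h1 := hf.tangent 0
  have h2 : Matrix.toLin' A = (σ : HorVec n →ₗ[ℝ] HorVec n) := by
    refine LinearMap.pi_ext' fun a => LinearMap.ext_ring ?_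
    have := congrArg Prod.fst (hA' a)
    simp only [heisFrame_eq, ← map_smul, ← map_sum] at this
    rw [hd, affL_apply, horLift_apply, horLift_apply] at this
    simp only at this
    simp only [LinearMap.comp_apply, LinearMap.single_apply]
    change _ = σ (Pi.single a 1)
    rw [this]
    ext b
    simp [Finset.sum_apply, Pi.single_apply]
  rw [hd, det_affL, ← h2, LinearMap.det_toLin'] at h1
  have h3 := pos_of_mul_pos_right h1 hA.le
  rcases hc with rfl | rfl
  · rfl
  · linarith

lemma exists_heisHomeo_eq {σ : HorVec n →L[ℝ] HorVec n}
    (hs : ∀ v w, stdSymp (σ v) (σ w) = stdSymp v w)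
    (hg : ∀ v w, diagForm ε (σ v) (σ w) = diagForm ε v w) :
    ∃ s ∈ spGroup n ⊓ oGroup ε, matL s = σ := by
  have hdet : (LinearMap.toMatrix' (σ : HorVec n →ₗ[ℝ] HorVec n)).det ≠ 0 := by
    rw [LinearMap.det_toMatrix', det_eq_one_of_symp (σ := (σ : HorVec n →ₗ[ℝ] HorVec n)) hs]
    exact one_ne_zero
  have h1 : matL (Matrix.GeneralLinearGroup.mkOfDetNeZero _ hdet) = σ := by
    ext1 v
    change Matrix.toLin' (LinearMap.toMatrix' (σ : HorVec n →ₗ[ℝ] HorVec n)) v = σ v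
    rw [Matrix.toLin'_toMatrix']; rfl
  refine ⟨_, ⟨fun v w => ?_, fun v w => ?_⟩, h1⟩
  · change stdSymp (matL _ v) (matL _ w) = _
    rw [h1, hs]
  · change diagForm ε (matL _ v) (matL _ w) = _
    rw [h1, hg]

end AffineIsometries

/-! ### The contact form, the frame and its brackets -/

section ContactForm

variable {n : ℕ}

lemma heisContactForm_apply (q v : HeisPt n) : heisContactForm q v = -vertPart q v := by
  simp only [heisContactForm, vertPart, stdSymp, sub_apply,
    smul_apply, sum_apply, smul_eq_mul,
    ContinuousLinearMap.comp_apply, ContinuousLinearMap.coe_fst', ContinuousLinearMap.coe_snd',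
    ContinuousLinearMap.proj_apply, neg_add, ← mul_neg, ← Finset.sum_neg_distrib, neg_sub]
  ring

lemma heisContactForm_eq (q : HeisPt n) : heisContactForm q =
    -(ContinuousLinearMap.snd ℝ (HorVec n) ℝ +
      (1 / 2 : ℝ) • (sympL n q.1).comp (ContinuousLinearMap.fst ℝ (HorVec n) ℝ)) := by
  refine ContinuousLinearMap.ext fun v => ?_
  rw [heisContactForm_apply]
  simp [vertPart, sympL_apply]

lemma contDiff_heisContactForm : ContDiff ℝ ∞ (heisContactForm (n := n)) := by
  rw [funext (heisContactForm_eq (n := n))]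
  fun_prop

/-- On a fixed vector the contact form is an affine function of the base point, so its differential
has constant coefficients. The two halves coming from the two orders of `v, w` add up by
antisymmetry. -/
lemma dOneForm_heisContactForm (q v w : HeisPt n) :
    dOneForm heisContactForm q v w = -stdSymp v.1 w.1 := by
  have hd : ∀ u t : HeisPt n,
      fderiv ℝ (fun x => heisContactForm x u) q t = -(1 / 2 * stdSymp t.1 u.1) := fun u t => by
    have h1 : (fun x : HeisPt n => heisContactForm x u) =
        fun x => -(u.2 + (1 / 2 : ℝ) * (sympL n).flip u.1 x.1) := funext fun x => by
      rw [heisContactForm_apply]; simp [vertPart, sympL_apply]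
    have h2 : HasFDerivAt (fun x : HeisPt n => -(u.2 + (1 / 2 : ℝ) * (sympL n).flip u.1 x.1))
        (-((1 / 2 : ℝ) • ((sympL n).flip u.1).comp (ContinuousLinearMap.fst ℝ (HorVec n) ℝ))) q :=
      (((((sympL n).flip u.1).hasFDerivAt.comp q hasFDerivAt_fst).const_mul
        (1 / 2 : ℝ)).const_add u.2).neg
    rw [h1, h2.fderiv]
    simp [sympL_apply]
  have hdiff : DifferentiableAt ℝ (fun x : HeisPt n =>
      ContinuousAlternatingMap.ofSubsingleton ℝ (HeisPt n) ℝ (0 : Fin 1) (heisContactForm x)) q :=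
    ((ContinuousAlternatingMap.ofSubsingletonLIE (𝕜 := ℝ) (E := HeisPt n) (F := ℝ)
      (0 : Fin 1)).toContinuousLinearEquiv.toContinuousLinearMap.differentiableAt).comp q
      (contDiff_heisContactForm.differentiable (by simp) q)
  rw [dOneForm, extDeriv_apply hdiff, Fin.sum_univ_two]
  simp only [ContinuousAlternatingMap.ofSubsingleton_apply_apply]
  rw [hd, hd]
  simp only [Fin.removeNth, Fin.val_zero, Fin.val_one, pow_zero, pow_one, one_smul, neg_smul]
  change -(1 / 2 * stdSymp v.1 w.1) + -(-(1 / 2 * stdSymp w.1 v.1)) = _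
  rw [stdSymp_swap w.1]
  ring

lemma contDiff_heisFrame (a : Fin n ⊕ Fin n) : ContDiff ℝ ∞ (heisFrame (n := n) a) := by
  have : heisFrame (n := n) a = fun q =>
      (Pi.single a 1, -(1 / 2) * sympL n q.1 (Pi.single a 1)) := funext fun q => by
    rw [heisFrame_eq, horLift_apply, sympL_apply]
  rw [this]
  fun_prop

lemma fst_heisFrame (a : Fin n ⊕ Fin n) (q : HeisPt n) : (heisFrame a q).1 = Pi.single a 1 := by
  rw [heisFrame_eq, horLift_apply]

lemma isOrthonormalFrame_heisFrame (ε : Fin n ⊕ Fin n → ℤˣ) :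
    IsOrthonormalFrame (heisStructure ε) heisFrame ε where
  smooth := contDiff_heisFrame
  linearIndependent q := by
    refine LinearIndependent.of_comp (LinearMap.fst ℝ (HorVec n) ℝ) ?_
    have : (LinearMap.fst ℝ (HorVec n) ℝ ∘ fun a => heisFrame a q) =
        Pi.basisFun ℝ (Fin n ⊕ Fin n) := funext fun a => by
      rw [Pi.basisFun_apply]; exact fst_heisFrame a q
    rw [this]
    exact (Pi.basisFun ℝ (Fin n ⊕ Fin n)).linearIndependent
  span_eq q := rfl
  metric q a b v w hv hw := by
    rw [heisStructure_g_apply, hv, hw, fst_heisFrame, fst_heisFrame, diagForm_single_right,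
      Pi.single_apply]
    by_cases h : a = b
    · simp [h]
    · simp [h, Ne.symm h]

lemma isNormalizedContactForm_heisContactForm (ε : Fin n ⊕ Fin n → ℤˣ) :
    IsNormalizedContactForm (heisStructure ε) heisFrame heisContactForm where
  smooth := contDiff_heisContactForm
  ne_zero q h := by
    have := DFunLike.congr_fun h (0, 1)
    rw [heisContactForm_apply] at this
    simp [vertPart] at this
  ker_eq q v := by rw [mem_H_iff, heisContactForm_apply, neg_eq_zero]
  nondegenerate q v hv h := by
    have h1 : v.1 = 0 := stdSymp_nondegenerate fun w => by
      have := h _ (horLift_mem_H ε q w)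
      rw [dOneForm_heisContactForm, horLift_apply] at this
      exact neg_eq_zero.1 this
    rw [mem_H_iff, vertPart, h1] at hv
    exact Prod.ext h1 (by simpa using hv)
  normalized q := by
    have : (Matrix.of fun a b => dOneForm heisContactForm q (heisFrame a q) (heisFrame b q)) =
        Matrix.J (Fin n) ℝ := by
      ext a b
      rw [Matrix.of_apply, dOneForm_heisContactForm, fst_heisFrame, fst_heisFrame,
        ← sympForm_apply, sympForm, Matrix.toBilin'_single, Matrix.neg_apply, neg_neg]
    rw [this, SymplecticGroup.det_eq_one (SymplecticGroup.J_mem _ _)]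

lemma lieBracket_heisFrame (i : Fin n) (q : HeisPt n) :
    VectorField.lieBracket ℝ (heisFrame (Sum.inl i)) (heisFrame (Sum.inr i)) q = (0, -1) := by
  have hd : ∀ (a : Fin n ⊕ Fin n) (t : HeisPt n),
      fderiv ℝ (heisFrame a) q t = (0, -(1 / 2) * stdSymp t.1 (Pi.single a 1)) := fun a t => by
    have h1 : heisFrame (n := n) a = fun q =>
        (Pi.single a 1, -(1 / 2) * (sympL n).flip (Pi.single a 1) q.1) := funext fun q => by
      rw [heisFrame_eq, horLift_apply, ContinuousLinearMap.flip_apply, sympL_apply]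
    have h2 := (hasFDerivAt_const (Pi.single a 1 : HorVec n) q).prodMk
      ((((sympL n).flip (Pi.single a 1)).hasFDerivAt.comp q hasFDerivAt_fst).const_mul
        (-(1 / 2) : ℝ))
    rw [h1]
    erw [h2.fderiv]
    simp [sympL_apply]
  rw [VectorField.lieBracket, hd, hd, fst_heisFrame, fst_heisFrame, stdSymp_single_inl,
    stdSymp_single_inr]
  refine Prod.ext ?_ ?_ <;> simp
  norm_num

lemma isBracketGenerating_heisFrame (hn : 1 ≤ n) : IsBracketGenerating (heisFrame (n := n)) := by
  intro q
  rw [eq_top_iff]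
  intro v _
  rw [Submodule.span_union, eq_horLift_add q v]
  refine Submodule.add_mem_sup ?_ (Submodule.smul_mem _ _ ?_)
  -- The distribution does not depend on the signs, so any choice serves.
  · exact horLift_mem_H (fun _ => 1) q v.1
  · rw [← neg_mem_iff]
    exact Submodule.subset_span ⟨(.inl ⟨0, hn⟩, .inr ⟨0, hn⟩), by
      simp only [lieBracket_heisFrame]; simp⟩

lemma fderiv_heisMul_heisFrame (p q : HeisPt n) (a : Fin n ⊕ Fin n) :
    fderiv ℝ (heisMul p) q (heisFrame a q) = heisFrame a (heisMul p q) := by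
  have h : ∀ q, heisMul p q = p + affL p (ContinuousLinearMap.id ℝ (HorVec n)) 1 q := fun q => by
    rw [← heisMul_eq_affL]; simp
  rw [fderiv_of_eq_affL h, heisFrame_eq, affL_horLift (fun _ _ => rfl), heisFrame_eq, h]
  rfl

end ContactForm

/-! ### The isomorphism and homeomorphism with the semidirect product -/

section SemidirectProduct

variable {n : ℕ} (ε : Fin n ⊕ Fin n → ℤˣ)

/-- The homomorphism from the semidirect product to the group of oriented isometries. -/
def semidirectToIsometry :
    Heis n ⋊[heisAction ε] (spGroup n ⊓ oGroup ε : Subgroup (GL (Fin n ⊕ Fin n) ℝ)) →*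
      orientedIsometryGroup (heisStructure ε) heisFrame where
  toFun s := ⟨heisHomeo s.left.toPt s.right.1, heisHomeo_mem_oriented _ s.right.2⟩
  map_one' := by
    ext1
    refine Homeomorph.ext fun q => ?_
    change heisHomeo (0 : HeisPt n) (1 : GL (Fin n ⊕ Fin n) ℝ) q = q
    rw [heisHomeo_apply, heisMul_eq]
    simp [fSigma]
  map_mul' s t := by
    ext1
    refine Homeomorph.ext fun q => ?_
    change heisHomeo (heisMul s.left.toPt (fSigma s.right.1 t.left.toPt)) (s.right.1 * t.right.1) q =
      heisHomeo s.left.toPt s.right.1 (heisHomeo t.left.toPt t.right.1 q)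
    simp only [heisHomeo_apply]
    have h1 : fSigma s.right.1 (heisMul t.left.toPt (fSigma t.right.1 q)) =
        heisMul (fSigma s.right.1 t.left.toPt) (fSigma (s.right.1 * t.right.1) q) := by
      rw [heisMul_eq, heisMul_eq]
      refine Prod.ext ?_ ?_
      · simp [fSigma, Matrix.mulVec_add, Matrix.mulVec_mulVec]
      · simp only [fSigma, Units.val_mul, ← Matrix.mulVec_mulVec]
        rw [s.right.2.1]
    rw [h1]
    exact mul_assoc (G := Heis n) _ _ _

lemma semidirectToIsometry_apply
    (s : Heis n ⋊[heisAction ε] (spGroup n ⊓ oGroup ε : Subgroup (GL (Fin n ⊕ Fin n) ℝ)))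
    (q : HeisPt n) :
    (semidirectToIsometry ε s).1 q = heisMul s.left.toPt (fSigma s.right.1 q) :=
  heisHomeo_apply _ _ _

/-- Coordinates on the group of homeomorphisms that recover the translational and the linear part
of an affine isometry. -/
def affineCoords (f : HeisPt n ≃ₜ HeisPt n) : HeisPt n × Matrix (Fin n ⊕ Fin n) (Fin n ⊕ Fin n) ℝ :=
  (f 0, Matrix.of fun i j => (f (Pi.single j 1, 0) - f 0).1 i)

lemma continuous_homeo_eval {E : Type*} [NormedAddCommGroup E] [NormedSpace ℝ E] (q : E) :
    Continuous fun f : E ≃ₜ E => f q :=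
  (ContinuousEvalConst.continuous_eval_const (F := C(E, E)) q).comp
    (continuous_induced_dom (f := fun f : E ≃ₜ E => (f : C(E, E))))

lemma continuous_affineCoords : Continuous (affineCoords (n := n)) := by
  refine (continuous_homeo_eval 0).prodMk (continuous_matrix fun i j => ?_)
  have h : Continuous fun f : HeisPt n ≃ₜ HeisPt n => f (Pi.single j 1, 0) - f 0 :=
    (continuous_homeo_eval _).sub (continuous_homeo_eval _)
  exact (continuous_apply i).comp h.fst

lemma affineCoords_heisHomeo (p : HeisPt n) (σ : GL (Fin n ⊕ Fin n) ℝ) :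
    affineCoords (heisHomeo p σ) = (p, σ.1) := by
  refine Prod.ext ?_ ?_
  · simp [affineCoords, heisHomeo_eq]
  · ext i j
    simp [affineCoords, heisHomeo_eq, affL_apply]

/-- The topology on units also records the inverse; matrix inversion is continuous where the
determinant is nonzero, so nothing is added to the subspace topology. -/
lemma isEmbedding_generalLinearGroup_val {ι : Type*} [Fintype ι] [DecidableEq ι] :
    Topology.IsEmbedding (Units.val : GL ι ℝ → Matrix ι ι ℝ) := by
  refine Units.isEmbedding_val_mk' (f := Inv.inv) (fun A hA => ?_) fun u => ?_
  · refine (continuousAt_matrix_inv A ?_).continuousWithinAt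
    have hd : A.det ≠ 0 := ((Matrix.isUnit_iff_isUnit_det A).1 hA).ne_zero
    rw [Ring.inverse_eq_inv']
    exact continuousAt_inv₀ hd
  · rw [Matrix.coe_units_inv]

/-- Joint continuity in the parameters and the point implies continuity into the compact-open
topology. -/
lemma continuous_heisHomeo : Continuous fun r : HeisPt n × GL (Fin n ⊕ Fin n) ℝ =>
    heisHomeo r.1 r.2 := by
  refine continuous_induced_rng.2 (ContinuousMap.continuous_of_continuous_uncurry _ ?_)
  change Continuous fun x : (HeisPt n × GL (Fin n ⊕ Fin n) ℝ) × HeisPt n =>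
    heisHomeo x.1.1 x.1.2 x.2
  have h1 : Continuous fun x : (HeisPt n × GL (Fin n ⊕ Fin n) ℝ) × HeisPt n =>
      x.1.2.1.mulVec x.2.1 :=
    (Units.continuous_val.comp (continuous_snd.comp continuous_fst)).matrix_mulVec
      (continuous_fst.comp continuous_snd)
  simp only [heisHomeo_apply, heisMul_eq, fSigma, ← sympL_apply]
  fun_prop

lemma bijective_semidirectToIsometry (hn : 1 ≤ n) :
    Function.Bijective (semidirectToIsometry ε) := by
  constructor
  · intro s t h
    have h1 := congrArg (fun f : orientedIsometryGroup (heisStructure ε) heisFrame =>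
      affineCoords f.1) h
    change affineCoords (heisHomeo _ _) = affineCoords (heisHomeo _ _) at h1
    rw [affineCoords_heisHomeo, affineCoords_heisHomeo, Prod.mk.injEq] at h1
    exact SemidirectProduct.ext h1.1 (Subtype.ext (Units.ext h1.2))
  · rintro ⟨f, hf, hf'⟩
    obtain ⟨σ, c, hc, hs, hg, h⟩ := hf.exists_affine hn
    have h2 : ∀ q, f q = f 0 + affL (f 0) σ c q := fun q => by rw [← heisMul_eq_affL]; exact h q
    obtain rfl := scale_eq_one_of_oriented hf' hc h2
    obtain ⟨s, hsm, rfl⟩ := exists_heisHomeo_eq (ε := ε) (fun v w => by rw [hs, one_mul]) hg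
    exact ⟨⟨f 0, ⟨s, hsm⟩⟩, Subtype.ext (Homeomorph.ext fun q => (h2 q).symm)⟩

/-- Composing with the continuous map `affineCoords` gives the inclusion into points and matrices.
That inclusion is inducing, hence so is the map itself. -/
lemma isHomeomorph_semidirectToIsometry (hn : 1 ≤ n) :
    IsHomeomorph fun r : Heis n ×
      (spGroup n ⊓ oGroup ε : Subgroup (GL (Fin n ⊕ Fin n) ℝ)) =>
        semidirectToIsometry ε ⟨r.1, r.2⟩ := by
  have hb : Function.Bijective fun r : Heis n ×
      (spGroup n ⊓ oGroup ε : Subgroup (GL (Fin n ⊕ Fin n) ℝ)) =>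
        semidirectToIsometry ε ⟨r.1, r.2⟩ :=
    (bijective_semidirectToIsometry ε hn).comp SemidirectProduct.equivProd.symm.bijective
  have hc : Continuous fun r : Heis n ×
      (spGroup n ⊓ oGroup ε : Subgroup (GL (Fin n ⊕ Fin n) ℝ)) =>
        semidirectToIsometry ε ⟨r.1, r.2⟩ :=
    (continuous_heisHomeo.comp (continuous_id.prodMap continuous_subtype_val)).subtype_mk _
  refine isHomeomorph_iff_isEmbedding_surjective.2 ⟨⟨?_, hb.1⟩, hb.2⟩
  refine Topology.IsInducing.of_comp hc (continuous_affineCoords.comp continuous_subtype_val) ?_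
  have h1 : Topology.IsInducing fun r : Heis n ×
      (spGroup n ⊓ oGroup ε : Subgroup (GL (Fin n ⊕ Fin n) ℝ)) => (r.1.toPt, r.2.1.1) :=
    Topology.IsInducing.prodMap (f := Heis.toPt) Topology.IsInducing.id
      (isEmbedding_generalLinearGroup_val.isInducing.comp Topology.IsInducing.subtypeVal)
  convert h1 using 1
  exact funext fun r => affineCoords_heisHomeo _ _

end SemidirectProduct

/-! ### The Cayley transform -/

section Cayley

variable {R : Type*} [Ring R]

/-- The Cayley transform. -/
def cayley (x : R) : R := (1 - x) * Ring.inverse (1 + x)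

lemma cayley_mul {x : R} (hx : IsUnit (1 + x)) : cayley x * (1 + x) = 1 - x := by
  rw [cayley, mul_assoc, Ring.inverse_mul_cancel _ hx, mul_one]

lemma one_add_cayley_mul {x : R} (hx : IsUnit (1 + x)) : (1 + cayley x) * (1 + x) = 2 := by
  rw [add_mul, cayley_mul hx, one_mul, add_add_sub_cancel, one_add_one_eq_two]

variable [Algebra ℝ R]

lemma isUnit_two_of_real_algebra : IsUnit (2 : R) := by
  have h : IsUnit (algebraMap ℝ R 2) := (isUnit_iff_ne_zero.2 two_ne_zero).map _
  rwa [map_ofNat] at h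

lemma isUnit_one_add_cayley {x : R} (hx : IsUnit (1 + x)) : IsUnit (1 + cayley x) := by
  have h : 1 + cayley x = 2 * Ring.inverse (1 + x) := by
    rw [Ring.eq_mul_inverse_iff_mul_eq _ _ _ hx, one_add_cayley_mul hx]
  rw [h]
  exact isUnit_two_of_real_algebra.mul hx.ringInverse

/-- The transform is an involution where defined, so one smooth formula serves both for the chart
and for its inverse. -/
lemma cayley_cayley {x : R} (hx : IsUnit (1 + x)) : cayley (cayley x) = x := by
  have h : x * (1 + cayley x) = 1 - cayley x := by
    refine hx.mul_right_cancel ?_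
    rw [mul_assoc, one_add_cayley_mul hx, sub_mul, cayley_mul hx, one_mul, add_sub_sub_cancel,
      mul_two]
  rw [cayley, ← h, Ring.mul_inverse_cancel_right _ _ (isUnit_one_add_cayley hx)]

lemma contDiffAt_cayley {R : Type*} [NormedRing R] [NormedAlgebra ℝ R] [CompleteSpace R] {x : R}
    (hx : IsUnit (1 + x)) : ContDiffAt ℝ ∞ (cayley : R → R) x := by
  obtain ⟨u, hu⟩ := hx
  have h1 : ContDiffAt ℝ ∞ (Ring.inverse : R → R) (1 + x) := hu ▸ contDiffAt_ringInverse ℝ u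
  have h2 : ContDiffAt ℝ ∞ (fun x : R => 1 + x) x := contDiffAt_const.add contDiffAt_id
  exact (contDiffAt_const.sub contDiffAt_id).mul (h1.comp x h2)

variable {W : Type*} [NormedAddCommGroup W] [NormedSpace ℝ W]

lemma surjective_of_isUnit {T : W →L[ℝ] W} (hT : IsUnit T) : Function.Surjective T := fun v =>
  ⟨Ring.inverse T v, DFunLike.congr_fun (Ring.mul_inverse_cancel T hT) v⟩

lemma cayley_apply {X : W →L[ℝ] W} (hX : IsUnit (1 + X)) (v : W) :
    cayley X ((1 + X) v) = (1 - X) v :=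
  DFunLike.congr_fun (cayley_mul hX) v

/-- After substituting `(1 + X)v` and `(1 + X)w`, the two sides differ by `-2` times the skewness
expression. -/
lemma cayley_isometry (B : LinearMap.BilinForm ℝ W) {X : W →L[ℝ] W} (hX : IsUnit (1 + X))
    (h : ∀ v w, B (X v) w + B v (X w) = 0) (v w : W) : B (cayley X v) (cayley X w) = B v w := by
  obtain ⟨v, rfl⟩ := surjective_of_isUnit hX v
  obtain ⟨w, rfl⟩ := surjective_of_isUnit hX w
  rw [cayley_apply hX, cayley_apply hX]
  simp only [add_apply, sub_apply, one_apply_eq_self, map_add, map_sub,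
    LinearMap.add_apply, LinearMap.sub_apply]
  linear_combination -2 * h v w

/-- The same substitution turns the left side into `2 (B(v, w) - B(σ v, σ w))`. -/
lemma cayley_skew (B : LinearMap.BilinForm ℝ W) {σ : W →L[ℝ] W} (hσ : IsUnit (1 + σ))
    (h : ∀ v w, B (σ v) (σ w) = B v w) (v w : W) : B (cayley σ v) w + B v (cayley σ w) = 0 := by
  obtain ⟨v, rfl⟩ := surjective_of_isUnit hσ v
  obtain ⟨w, rfl⟩ := surjective_of_isUnit hσ w
  rw [cayley_apply hσ, cayley_apply hσ]
  simp only [add_apply, sub_apply, one_apply_eq_self, map_add, map_sub,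
    LinearMap.add_apply, LinearMap.sub_apply]
  linear_combination -2 * h v w

end Cayley

/-! ### The Lie algebra and its dimension -/

section LieAlgebra

variable {n : ℕ} (ε : Fin n ⊕ Fin n → ℤˣ)

/-- The Lie algebra of `Sp(ω) ∩ O(g)`. -/
def isoAlgebra : Submodule ℝ (HorVec n →L[ℝ] HorVec n) where
  carrier := {X | (∀ v w, sympForm n (X v) w + sympForm n v (X w) = 0) ∧
    ∀ v w, diagForm ε (X v) w + diagForm ε v (X w) = 0}
  zero_mem' := by simp
  add_mem' := by
    rintro X Y ⟨hX, hX'⟩ ⟨hY, hY'⟩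
    refine ⟨fun v w => ?_, fun v w => ?_⟩ <;>
      simp only [add_apply, map_add, LinearMap.add_apply]
    · linear_combination hX v w + hY v w
    · linear_combination hX' v w + hY' v w
  smul_mem' := by
    rintro c X ⟨hX, hX'⟩
    refine ⟨fun v w => ?_, fun v w => ?_⟩ <;>
      simp only [smul_apply, map_smul, LinearMap.smul_apply, smul_eq_mul, ← mul_add]
    · rw [hX, mul_zero]
    · rw [hX', mul_zero]

instance : Module.Free ℝ (isoAlgebra ε) := 
  Module.Free.of_divisionRing ℝ (isoAlgebra ε)

lemma skew_of_basis {B : LinearMap.BilinForm ℝ (HorVec n)} {X : HorVec n →L[ℝ] HorVec n}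
    (h : ∀ a b, B (X (Pi.single a 1)) (Pi.single b 1) + B (Pi.single a 1) (X (Pi.single b 1)) = 0)
    (v w : HorVec n) : B (X v) w + B v (X w) = 0 := by
  have : B.compLeft (X : HorVec n →ₗ[ℝ] HorVec n) + B.compRight (X : HorVec n →ₗ[ℝ] HorVec n) = 0 :=
    LinearMap.BilinForm.ext_basis (Pi.basisFun ℝ _) fun a b => by
      simpa using h a b
  exact LinearMap.congr_fun₂ this v w

/-- The matrix entries of an endomorphism. -/
def entry (X : HorVec n →L[ℝ] HorVec n) (a b : Fin n ⊕ Fin n) : ℝ := X (Pi.single b 1) a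

lemma mem_isoAlgebra_iff (X : HorVec n →L[ℝ] HorVec n) : X ∈ isoAlgebra ε ↔
    (∀ i j, entry X (.inr i) (.inr j) = -entry X (.inl j) (.inl i)) ∧
    (∀ i j, entry X (.inl i) (.inr j) = entry X (.inl j) (.inr i)) ∧
    (∀ i j, entry X (.inr i) (.inl j) = entry X (.inr j) (.inl i)) ∧
    ∀ a b, ((ε a : ℤ) : ℝ) * entry X a b + ((ε b : ℤ) : ℝ) * entry X b a = 0 := by
  have hg : ∀ a b, diagForm ε (X (Pi.single b 1)) (Pi.single a 1) +
      diagForm ε (Pi.single b 1) (X (Pi.single a 1)) =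
      ((ε a : ℤ) : ℝ) * entry X a b + ((ε b : ℤ) : ℝ) * entry X b a := fun a b => by
    rw [diagForm_comm ε (Pi.single b 1), diagForm_single_right, diagForm_single_right]; rfl
  constructor
  · rintro ⟨hs, h⟩
    refine ⟨fun i j => ?_, fun i j => ?_, fun i j => ?_, fun a b => (hg a b).symm.trans (h _ _)⟩
    · have := hs (Pi.single (.inl i) 1) (Pi.single (.inr j) 1)
      rw [sympForm_apply, sympForm_apply, stdSymp_swap (Pi.single _ _), stdSymp_single_inl,
        stdSymp_single_inr] at this
      simp only [entry]; linarith
    · have := hs (Pi.single (.inr j) 1) (Pi.single (.inr i) 1)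
      rw [sympForm_apply, sympForm_apply, stdSymp_swap (Pi.single _ _), stdSymp_single_inr,
        stdSymp_single_inr] at this
      simp only [entry]; linarith
    · have := hs (Pi.single (.inl i) 1) (Pi.single (.inl j) 1)
      rw [sympForm_apply, sympForm_apply, stdSymp_swap (Pi.single _ _), stdSymp_single_inl,
        stdSymp_single_inl] at this
      simp only [entry]; linarith
  · rintro ⟨h1, h2, h3, h4⟩
    refine ⟨skew_of_basis ?_, skew_of_basis fun b a => (hg a b).trans (h4 a b)⟩
    simp only [entry] at h1 h2 h3
    rintro (i | i) (j | j) <;>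
      rw [sympForm_apply, sympForm_apply, stdSymp_swap (Pi.single _ _)]
    · rw [stdSymp_single_inl, stdSymp_single_inl, h3 i j]; ring
    · rw [stdSymp_single_inl, stdSymp_single_inr, h1 i j]; ring
    · rw [stdSymp_single_inl, stdSymp_single_inr, h1 j i]; ring
    · rw [stdSymp_single_inr, stdSymp_single_inr, h2 i j]; ring

/-- The product of the signs of `X_i` and `Y_i`. -/
def pairSign (i : Fin n) : ℤˣ := ε (.inl i) * ε (.inr i)

lemma pairSign_eq_iff (i j : Fin n) : pairSign ε i = pairSign ε j ↔
    ((ε (.inl i) : ℤ) : ℝ) * ((ε (.inr i) : ℤ) : ℝ) =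
      ((ε (.inl j) : ℤ) : ℝ) * ((ε (.inr j) : ℤ) : ℝ) := by
  rw [Units.ext_iff, pairSign, pairSign, Units.val_mul, Units.val_mul]
  exact_mod_cast Iff.rfl

/-- Independent coordinates on the Lie algebra of `Sp(ω) ∩ O(g)`. -/
def isoAlgebraCoords :
    isoAlgebra ε →ₗ[ℝ] ({p : Fin n × Fin n // pairSign ε p.1 = pairSign ε p.2} → ℝ) where
  -- Write `X` in blocks `A, B, C, D`. Skewness determines `A` by its strict upper triangle,
  -- symmetry determines `B` by its lower triangle with diagonal, `C` follows from `B`, and `D =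
  -- -Aᵀ`. Together these use each ordered pair once.
  toFun X p := if p.1.1 < p.1.2 then entry X.1 (.inl p.1.1) (.inl p.1.2)
    else entry X.1 (.inl p.1.1) (.inr p.1.2)
  map_add' X Y := by
    ext p; simp only [entry, Submodule.coe_add, add_apply, Pi.add_apply]; split_ifs <;> rfl
  map_smul' c X := by
    ext p
    simp only [entry, Submodule.coe_smul, smul_apply, Pi.smul_apply, RingHom.id_apply]
    split_ifs <;> rfl

lemma isoAlgebraCoords_injective : Function.Injective (isoAlgebraCoords ε) := by
  rw [injective_iff_map_eq_zero]
  rintro ⟨X, hX⟩ h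
  obtain ⟨h1, h2, h3, h4⟩ := (mem_isoAlgebra_iff ε X).1 hX
  have hc : ∀ i j, pairSign ε i = pairSign ε j → (if i < j then entry X (.inl i) (.inl j)
    else entry X (.inl i) (.inr j)) = 0 := fun i j hij => congrFun h ⟨(i, j), hij⟩
  have hA : ∀ i j, entry X (.inl i) (.inl j) = 0 := by
    intro i j
    by_cases hij : pairSign ε i = pairSign ε j
    · rcases lt_trichotomy i j with h | rfl | h
      · simpa [h] using hc i j hij
      · have := h4 (.inl i) (.inl i)
        exact (mul_eq_zero.1 (show ((ε (.inl i) : ℤ) : ℝ) * entry X (.inl i) (.inl i) = 0 by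
          linarith)).resolve_left (coe_sign_ne_zero ε _)
      · have h5 := hc j i hij.symm
        rw [if_pos h] at h5
        have := h4 (.inl i) (.inl j)
        rw [h5, mul_zero, add_zero] at this
        exact (mul_eq_zero.1 this).resolve_left (coe_sign_ne_zero ε _)
    · rw [pairSign_eq_iff] at hij
      -- The conditions on `A` and on `D = -Aᵀ` form a linear system in `A i j` and `A j i`;
      -- eliminating `A j i` leaves the factor `t_i s_i - t_j s_j`, nonzero here. The argument for
      -- `B` eliminates `C` in the same way.
      have e1 := h4 (.inl i) (.inl j)
      have e2 := h4 (.inr j) (.inr i)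
      rw [h1, h1] at e2
      refine eq_zero_of_ne_zero_of_mul_left_eq_zero (sub_ne_zero.2 hij) ?_
      linear_combination ((ε (.inr i) : ℤ) : ℝ) * e1 + ((ε (.inl j) : ℤ) : ℝ) * e2
  have hB : ∀ i j, entry X (.inl i) (.inr j) = 0 := by
    intro i j
    by_cases hij : pairSign ε i = pairSign ε j
    · rcases lt_or_ge i j with h | h
      · have h5 := hc j i hij.symm
        rw [if_neg h.not_gt] at h5
        rw [h2, h5]
      · simpa [h.not_gt] using hc i j hij
    · rw [pairSign_eq_iff] at hij
      have e1 := h4 (.inl i) (.inr j)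
      have e2 := h4 (.inl j) (.inr i)
      rw [h3 j i] at e1
      rw [h2 j i] at e2
      refine eq_zero_of_ne_zero_of_mul_left_eq_zero (sub_ne_zero.2 hij) ?_
      linear_combination ((ε (.inr i) : ℤ) : ℝ) * e1 - ((ε (.inr j) : ℤ) : ℝ) * e2
  have hC : ∀ i j, entry X (.inr i) (.inl j) = 0 := by
    intro i j
    have := h4 (.inr i) (.inl j)
    rw [hB, mul_zero, add_zero] at this
    exact (mul_eq_zero.1 this).resolve_left (coe_sign_ne_zero ε _)
  refine Subtype.ext (ContinuousLinearMap.coe_inj.1 (LinearMap.pi_ext' fun b =>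
    LinearMap.ext_ring (funext fun a => ?_)))
  change entry X a b = 0
  rcases a with i | i <;> rcases b with j | j
  · exact hA i j
  · exact hB i j
  · exact hC i j
  · rw [h1, hA, neg_zero]

/-- The free entries, extended by zero to pairs of unequal sign products, are completed to a matrix
by the forced relations. Equality of the products makes these relations compatible. -/
lemma isoAlgebraCoords_surjective : Function.Surjective (isoAlgebraCoords ε) := by
  intro M
  let N : Fin n → Fin n → ℝ := fun i j =>
    if h : pairSign ε i = pairSign ε j then M ⟨(i, j), h⟩ else 0
  have hN : ∀ i j, pairSign ε i ≠ pairSign ε j → N i j = 0 := fun i j h => dif_neg h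
  let t : Fin n → ℝ := fun i => ((ε (.inl i) : ℤ) : ℝ)
  let s : Fin n → ℝ := fun i => ((ε (.inr i) : ℤ) : ℝ)
  have ht : ∀ i, t i * t i = 1 := fun i => coe_sign_mul_self ε _
  have hs : ∀ i, s i * s i = 1 := fun i => coe_sign_mul_self ε _
  have hts : ∀ i j, pairSign ε i = pairSign ε j → t i * s i = t j * s j := fun i j h =>
    (pairSign_eq_iff ε i j).1 h
  let A : Matrix (Fin n) (Fin n) ℝ := fun i j =>
    if i < j then N i j else if j < i then -(t i * t j * N j i) else 0
  let B : Matrix (Fin n) (Fin n) ℝ := fun i j => if i < j then N j i else N i j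
  have hA0 : ∀ i j, pairSign ε i ≠ pairSign ε j → A i j = 0 := fun i j h => by
    simp [A, hN i j h, hN j i h.symm]
  have hB0 : ∀ i j, pairSign ε i ≠ pairSign ε j → B i j = 0 := fun i j h => by
    simp [B, hN i j h, hN j i h.symm]
  have hA : ∀ i j, t i * A i j + t j * A j i = 0 := by
    have key : ∀ i j, i < j → t i * A i j + t j * A j i = 0 := fun i j h => by
      simp only [A, if_pos h, if_neg h.not_gt]
      linear_combination -(t i * N i j) * ht j
    intro i j
    rcases lt_trichotomy i j with h | rfl | h
    · exact key i j h
    · simp [A]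
    · rw [add_comm]; exact key j i h
  have hB : ∀ i j, B i j = B j i := by
    have key : ∀ i j, i < j → B i j = B j i := fun i j h => by
      simp only [B, if_pos h, if_neg h.not_gt]
    intro i j
    rcases lt_trichotomy i j with h | rfl | h
    · exact key i j h
    · rfl
    · exact (key j i h).symm
  -- Forced by skewness for the diagonal form. Its symmetry amounts to `s_i t_j = s_j t_i`, which is
  -- equivalent to equality of the sign products.
  let C : Matrix (Fin n) (Fin n) ℝ := fun i j => -(s i * t j * B i j)
  have hC : ∀ i j, C i j = C j i := fun i j => by
    by_cases h : pairSign ε i = pairSign ε j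
    · have h1 := hts i j h
      simp only [C, hB j i]
      linear_combination B i j * (-(t i * t j) * h1 + s i * t j * ht i - t i * s j * ht j)
    · simp [C, hB0 i j h, hB0 j i (Ne.symm h)]
  have hD : ∀ i j, s i * A j i + s j * A i j = 0 := fun i j => by
    by_cases h : pairSign ε i = pairSign ε j
    · have h1 := hts i j h
      linear_combination s i * t j * hA i j - A i j * t j * h1 -
        (s i * A j i + s j * A i j) * ht j
    · simp [hA0 i j h, hA0 j i (Ne.symm h)]
  let X : HorVec n →L[ℝ] HorVec n :=
    (Matrix.toLin' (Matrix.fromBlocks A B C (-A.transpose))).toContinuousLinearMap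
  have hX : ∀ a b, entry X a b = Matrix.fromBlocks A B C (-A.transpose) a b := fun a b => by
    simp [entry, X]
  have hmem : X ∈ isoAlgebra ε := by
    rw [mem_isoAlgebra_iff]
    simp only [hX]
    refine ⟨fun i j => rfl, hB, hC, ?_⟩
    rintro (i | i) (j | j)
    · exact hA i j
    · change t i * B i j + s j * -(s j * t i * B j i) = 0
      rw [hB j i]
      linear_combination -(t i * B i j) * hs j
    · change s i * -(s i * t j * B i j) + t j * B j i = 0
      rw [hB j i]
      linear_combination -(t j * B i j) * hs i
    · change s i * -A j i + s j * -A i j = 0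
      linear_combination -hD i j
  refine ⟨⟨X, hmem⟩, funext fun ⟨⟨i, j⟩, hij⟩ => ?_⟩
  change (if i < j then entry X (.inl i) (.inl j) else entry X (.inl i) (.inr j)) = _
  rw [hX, hX]
  have hNM : N i j = M ⟨(i, j), hij⟩ := dif_pos hij
  by_cases h : i < j
  · rw [if_pos h]
    exact (if_pos h).trans hNM
  · rw [if_neg h]
    exact (if_neg h).trans hNM

lemma finrank_isoAlgebra : Module.finrank ℝ (isoAlgebra ε) =
    Fintype.card {p : Fin n × Fin n // pairSign ε p.1 = pairSign ε p.2} := by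
  rw [(LinearEquiv.ofBijective _ ⟨isoAlgebraCoords_injective ε,
    isoAlgebraCoords_surjective ε⟩).finrank_eq, Module.finrank_pi]

end LieAlgebra

/-! ### One-jets and the Lie group structure -/

section LieGroup

variable {n : ℕ} {ε : Fin n ⊕ Fin n → ℤˣ}

/-- The value and the differential at the origin. -/
def oneJet (f : HeisPt n ≃ₜ HeisPt n) : HeisPt n × (HeisPt n →L[ℝ] HeisPt n) :=
  (f 0, fderiv ℝ f 0)

lemma IsSubIsometry.exists_affL (hn : 1 ≤ n) {f : HeisPt n ≃ₜ HeisPt n}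
    (hf : IsSubIsometry (heisStructure ε) f) :
    ∃ (σ : HorVec n →L[ℝ] HorVec n) (c : ℝ), (c = 1 ∨ c = -1) ∧
      (∀ v w, stdSymp (σ v) (σ w) = c * stdSymp v w) ∧
      (∀ v w, diagForm ε (σ v) (σ w) = diagForm ε v w) ∧
      (∀ q, f q = f 0 + affL (f 0) σ c q) ∧ ∀ q, fderiv ℝ f q = affL (f 0) σ c := by
  obtain ⟨σ, c, hc, hs, hg, h⟩ := hf.exists_affine hn
  have h2 : ∀ q, f q = f 0 + affL (f 0) σ c q := fun q => by rw [← heisMul_eq_affL]; exact h q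
  exact ⟨σ, c, hc, hs, hg, h2, fderiv_of_eq_affL h2⟩

lemma IsSubIsometry.eq_oneJet (hn : 1 ≤ n) {f : HeisPt n ≃ₜ HeisPt n}
    (hf : IsSubIsometry (heisStructure ε) f) (q : HeisPt n) :
    f q = (oneJet f).1 + (oneJet f).2 q := by
  obtain ⟨σ, c, -, -, -, h, hd⟩ := hf.exists_affL hn
  rw [oneJet, hd]; exact h q

/-- The differential of an affine map is the same at every point, so jets at the origin compose as
in the affine group. -/
lemma oneJet_mul (hn : 1 ≤ n) {f g : HeisPt n ≃ₜ HeisPt n}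
    (hf : IsSubIsometry (heisStructure ε) f) (hg : IsSubIsometry (heisStructure ε) g) :
    oneJet (f * g) =
      ((oneJet f).1 + (oneJet f).2 (oneJet g).1, (oneJet f).2 * (oneJet g).2) := by
  refine Prod.ext (hf.eq_oneJet hn (g 0)) ?_
  obtain ⟨σ, c, -, -, -, h, hd⟩ := hf.exists_affL hn
  change fderiv ℝ (f * g : HeisPt n ≃ₜ HeisPt n) 0 = fderiv ℝ f 0 * fderiv ℝ g 0
  rw [fderiv_homeo_mul hf.smooth hg.smooth, hd, hd]; rfl

lemma oneJet_one : oneJet (1 : HeisPt n ≃ₜ HeisPt n) = (0, 1) :=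
  Prod.ext rfl (fderiv_id (𝕜 := ℝ) (x := (0 : HeisPt n)))

lemma oneJet_inv (hn : 1 ≤ n) {f : HeisPt n ≃ₜ HeisPt n}
    (hf : IsSubIsometry (heisStructure ε) f) :
    IsUnit (oneJet f).2 ∧ oneJet f⁻¹ =
      (-(Ring.inverse (oneJet f).2 (oneJet f).1), Ring.inverse (oneJet f).2) := by
  have h1 := oneJet_mul hn hf.inv hf
  have h2 := oneJet_mul hn hf hf.inv
  rw [inv_mul_cancel, oneJet_one, Prod.mk.injEq] at h1
  rw [mul_inv_cancel, oneJet_one, Prod.mk.injEq] at h2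
  let u : (HeisPt n →L[ℝ] HeisPt n)ˣ := ⟨(oneJet f).2, (oneJet f⁻¹).2, h2.2.symm, h1.2.symm⟩
  have hu : Ring.inverse (oneJet f).2 = (oneJet f⁻¹).2 := Ring.inverse_unit u
  refine ⟨u.isUnit, Prod.ext ?_ hu.symm⟩
  change (oneJet f⁻¹).1 = -(Ring.inverse (oneJet f).2 (oneJet f).1)
  rw [hu]
  exact eq_neg_of_add_eq_zero_left h1.1.symm

/-- The horizontal block of an endomorphism. -/
def horBlock (A : HeisPt n →L[ℝ] HeisPt n) : HorVec n →L[ℝ] HorVec n :=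
  (ContinuousLinearMap.fst ℝ (HorVec n) ℝ).comp (A.comp (ContinuousLinearMap.inl ℝ (HorVec n) ℝ))

lemma horBlock_affL (p : HeisPt n) (σ : HorVec n →L[ℝ] HorVec n) (c : ℝ) :
    horBlock (affL p σ c) = σ := by
  ext1 v
  change (affL p σ c (v, 0)).1 = σ v
  rw [affL_apply]

lemma contDiff_horBlock : ContDiff ℝ ∞ (horBlock (n := n)) := by
  unfold horBlock
  exact contDiff_const.clm_comp (contDiff_id.clm_comp contDiff_const)

lemma affL_vert (p : HeisPt n) (σ : HorVec n →L[ℝ] HorVec n) (c : ℝ) :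
    (affL p σ c (0, 1)).2 = c := by
  rw [affL_apply]; simp

lemma contDiff_affL (c : ℝ) :
    ContDiff ℝ ∞ fun x : HeisPt n × (HorVec n →L[ℝ] HorVec n) => affL x.1 x.2 c := by
  refine contDiff_clm_apply_iff.2 fun y => ?_
  simp only [affL_apply, ← sympL_apply]
  have h : ContDiff ℝ ∞ fun x : HeisPt n × (HorVec n →L[ℝ] HorVec n) => x.2 y.1 :=
    contDiff_snd.clm_apply contDiff_const
  exact h.prodMk (contDiff_const.sub (contDiff_const.mul
    (((sympL n).contDiff.comp contDiff_fst.fst).clm_apply h)))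

/-- The projection `P` is defined on all of `W`, so the chart built from it is the restriction of a
map on the ambient space. -/
lemma exists_euclidean_coords {W : Type*} [NormedAddCommGroup W] [NormedSpace ℝ W]
    [FiniteDimensional ℝ W] (K : Submodule ℝ W) :
    ∃ (a : EuclideanSpace ℝ (Fin (Module.finrank ℝ K)) →L[ℝ] W)
      (P : W →L[ℝ] EuclideanSpace ℝ (Fin (Module.finrank ℝ K))),
      (∀ y, a y ∈ K) ∧ (∀ y, P (a y) = y) ∧ ∀ X ∈ K, a (P X) = X := by
  obtain ⟨P, hP⟩ := K.subtype.exists_leftInverse_of_injective K.ker_subtype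
  have hP' : ∀ X : K, P X = X := fun X => LinearMap.congr_fun hP X
  let e : K ≃L[ℝ] EuclideanSpace ℝ (Fin (Module.finrank ℝ K)) :=
    ContinuousLinearEquiv.ofFinrankEq finrank_euclideanSpace_fin.symm
  refine ⟨K.subtypeL.comp e.symm.toContinuousLinearMap,
    e.toContinuousLinearMap.comp P.toContinuousLinearMap, fun y => (e.symm y).2, fun y => ?_,
    fun X hX => ?_⟩
  · change e (P (e.symm y)) = y
    rw [hP', e.apply_symm_apply]
  · change (e.symm (e (P X)) : W) = X
    rw [e.symm_apply_apply, hP' ⟨X, hX⟩]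

variable {Γ : Subgroup (HeisPt n ≃ₜ HeisPt n)}

/-- For affine maps the differential is a difference of two values, and evaluations are continuous
in the compact-open topology. -/
lemma continuous_oneJet (hn : 1 ≤ n) (hΓ : Γ ≤ isometryGroup (heisStructure ε)) :
    Continuous fun f : Γ => oneJet f.1 := by
  have hev : ∀ q, Continuous fun f : Γ => f.1 q := fun q =>
    (continuous_homeo_eval q).comp continuous_subtype_val
  refine (hev 0).prodMk (continuous_clm_apply.2 fun q => ?_)
  have : (fun f : Γ => fderiv ℝ f.1 0 q) = fun f => f.1 q - f.1 0 := funext fun f => by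
    rw [(hΓ f.2 : IsSubIsometry _ _).eq_oneJet hn q]
    simp [oneJet]
  rw [this]
  exact (hev q).sub (hev 0)

/-- The jet determines the map, and the affine map with a given jet depends continuously on the jet
in the compact-open topology. -/
lemma isInducing_oneJet (hn : 1 ≤ n) (hΓ : Γ ≤ isometryGroup (heisStructure ε)) :
    Topology.IsInducing fun f : Γ => oneJet f.1 := by
  let J : HeisPt n × (HeisPt n →L[ℝ] HeisPt n) → C(HeisPt n, HeisPt n) := fun x =>
    ⟨fun q => x.1 + x.2 q, by fun_prop⟩
  have hJ : Continuous J := ContinuousMap.continuous_of_continuous_uncurry _ (by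
    change Continuous fun y : (HeisPt n × (HeisPt n →L[ℝ] HeisPt n)) × HeisPt n =>
      y.1.1 + y.1.2 y.2
    fun_prop)
  refine Topology.IsInducing.of_comp (continuous_oneJet hn hΓ) hJ ?_
  have h1 : Topology.IsInducing fun f : Γ => ((f.1 : HeisPt n ≃ₜ HeisPt n) : C(HeisPt n, HeisPt n)) :=
    Topology.IsInducing.comp
      (g := fun f : HeisPt n ≃ₜ HeisPt n => (f : C(HeisPt n, HeisPt n))) ⟨rfl⟩
      Topology.IsInducing.subtypeVal
  convert h1 using 1
  exact funext fun f => ContinuousMap.ext fun q =>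
    ((hΓ f.2 : IsSubIsometry _ _).eq_oneJet hn q).symm

lemma injective_oneJet (hn : 1 ≤ n) (hΓ : Γ ≤ isometryGroup (heisStructure ε)) :
    Function.Injective fun f : Γ => oneJet f.1 := fun f g h =>
  Subtype.ext (Homeomorph.ext fun q => by
    rw [(hΓ f.2 : IsSubIsometry _ _).eq_oneJet hn q, (hΓ g.2 : IsSubIsometry _ _).eq_oneJet hn q]
    simp only at h
    rw [h])

/-- Every group of isometries that contains all oriented ones is a Lie group. -/
theorem isLieGroupOfDim_of_oriented_le (hn : 1 ≤ n) (hΓ : Γ ≤ isometryGroup (heisStructure ε))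
    (hΓ' : orientedIsometryGroup (heisStructure ε) heisFrame ≤ Γ) {d : ℕ}
    (hd : d = 2 * n + 1 + Module.finrank ℝ (isoAlgebra ε)) : IsLieGroupOfDim Γ d := by
  have hind := isInducing_oneJet hn hΓ
  have hinj := injective_oneJet hn hΓ
  refine ⟨T2Space.of_injective_continuous hinj hind.continuous, ?_, ?_⟩
  · have : ProperSpace (HeisPt n × (HeisPt n →L[ℝ] HeisPt n)) := FiniteDimensional.proper ℝ _
    exact hind.secondCountableTopology
  have hiso : ∀ f : Γ, IsSubIsometry (heisStructure ε) f.1 := fun f => hΓ f.2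
  obtain ⟨a, P, ha, hPa, haP⟩ := exists_euclidean_coords (isoAlgebra ε)
  let e : (HeisPt n × EuclideanSpace ℝ (Fin (Module.finrank ℝ (isoAlgebra ε)))) ≃L[ℝ]
      EuclideanSpace ℝ (Fin d) :=
    ContinuousLinearEquiv.ofFinrankEq (by
      rw [finrank_euclideanSpace_fin, hd, Module.finrank_prod, finrank_euclideanSpace_fin]
      simp [two_mul])
  -- Near the identity the vertical scale is positive, hence `c = 1`. So the chart sees only
  -- isometries with symplectic linear part, and it is the same for the full and for the oriented
  -- group.
  have hcay : ∀ f : Γ, 0 < ((oneJet f.1).2 (0, 1)).2 → IsUnit (1 + horBlock (oneJet f.1).2) →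
      cayley (horBlock (oneJet f.1).2) ∈ isoAlgebra ε ∧
      (oneJet f.1).2 = affL (oneJet f.1).1 (horBlock (oneJet f.1).2) 1 := by
    intro f hf hu
    obtain ⟨σ, c, hc, hs, hg, -, hfd⟩ := (hiso f).exists_affL hn
    have h2 : (oneJet f.1).2 = affL (f.1 0) σ c := hfd 0
    rw [h2, affL_vert] at hf
    obtain rfl : c = 1 := hc.resolve_right (by rintro rfl; linarith)
    rw [h2, horBlock_affL] at hu ⊢
    refine ⟨⟨cayley_skew _ hu fun v w => ?_, cayley_skew _ hu hg⟩, rfl⟩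
    rw [sympForm_apply, sympForm_apply, hs, one_mul]
  refine exists_lieGroup_of_parametrization (ι := fun f : Γ => oneJet f.1) hind hinj
    (m := fun x y => (x.1 + x.2 y.1, x.2 * y.2)) ?_
    (fun f g => oneJet_mul hn (hiso f) (hiso g))
    (i := fun x => (-(Ring.inverse x.2 x.1), Ring.inverse x.2)) (fun f => ?_)
    (fun f => (oneJet_inv hn (hiso f)).2)
    (U := {f : Γ | 0 < ((oneJet f.1).2 (0, 1)).2 ∧ IsUnit (1 + horBlock (oneJet f.1).2)}) ?_ ?_
    (T := {y | IsUnit (1 + a (e.symm y).2)}) ?_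
    (F := fun x => e (x.1, P (cayley (horBlock x.2)))) (fun f hf => ?_)
    (S := fun y => ((e.symm y).1, affL (e.symm y).1 (cayley (a (e.symm y).2)) 1))
    (fun y hy => ?_) (fun y hy => ?_) (fun f hf => ?_) (fun f hf => ?_) (fun y hy => ?_)
  · exact (contDiff_fst.fst.add (contDiff_fst.snd.clm_apply contDiff_snd.fst)).prodMk
      (contDiff_fst.snd.clm_comp contDiff_snd.snd)
  · obtain ⟨u, hu⟩ := (oneJet_inv hn (hiso f)).1
    have h1 : ContDiffAt ℝ ∞ (Ring.inverse : (HeisPt n →L[ℝ] HeisPt n) → _) (oneJet f.1).2 :=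
      hu ▸ contDiffAt_ringInverse ℝ u
    have h2 : ContDiffAt ℝ ∞ (fun x : HeisPt n × (HeisPt n →L[ℝ] HeisPt n) => Ring.inverse x.2)
        (oneJet f.1) := h1.comp _ contDiffAt_snd
    exact (h2.clm_apply contDiffAt_fst).neg.prodMk h2
  · have h1 : Continuous fun f : Γ => (oneJet f.1).2 := hind.continuous.snd
    refine (isOpen_lt continuous_const (h1.clm_apply continuous_const).snd).inter ?_
    exact Units.isOpen.preimage (continuous_const.add (contDiff_horBlock.continuous.comp h1))
  · change 0 < ((oneJet (1 : HeisPt n ≃ₜ HeisPt n)).2 (0, 1)).2 ∧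
      IsUnit (1 + horBlock (oneJet (1 : HeisPt n ≃ₜ HeisPt n)).2)
    have h1 : horBlock (1 : HeisPt n →L[ℝ] HeisPt n) = 1 := rfl
    rw [oneJet_one, h1, one_add_one_eq_two]
    exact ⟨one_pos, isUnit_two_of_real_algebra⟩
  · exact Units.isOpen.preimage (continuous_const.add
      (a.continuous.comp e.symm.continuous.snd))
  · refine e.contDiff.contDiffAt.comp _ (contDiffAt_fst.prodMk ?_)
    have h1 : ContDiffAt ℝ ∞ (fun x : HeisPt n × (HeisPt n →L[ℝ] HeisPt n) =>
        cayley (horBlock x.2)) (oneJet f.1) :=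
      ContDiffAt.comp (g := cayley) (f := fun x : HeisPt n × (HeisPt n →L[ℝ] HeisPt n) =>
        horBlock x.2) _ (contDiffAt_cayley hf.2) (contDiff_horBlock.comp contDiff_snd).contDiffAt
    exact P.contDiff.comp_contDiffAt _ h1
  · have h0 : ContDiffAt ℝ ∞ (fun y => a (e.symm y).2) y :=
      (a.contDiff.comp e.symm.contDiff.snd).contDiffAt
    have h1 : ContDiffAt ℝ ∞ (fun y => cayley (a (e.symm y).2)) y :=
      ContDiffAt.comp (g := cayley) (f := fun y => a (e.symm y).2) y (contDiffAt_cayley hy) h0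
    have h2 : ContDiffAt ℝ ∞ (fun y => (e.symm y).1) y := e.symm.contDiff.fst.contDiffAt
    exact (h2.prodMk ((contDiff_affL 1).contDiffAt.comp y (h2.prodMk h1))).contDiffWithinAt
  -- The parametrization takes values in oriented isometries, hence in `Γ` because `Γ` contains them
  -- all.
  · obtain ⟨hX, hX'⟩ := ha (e.symm y).2
    obtain ⟨s, hs, hsσ⟩ := exists_heisHomeo_eq (ε := ε)
      (σ := cayley (a (e.symm y).2))
      (fun v w => by simpa only [← sympForm_apply] using cayley_isometry _ hy hX v w)
      (cayley_isometry _ hy hX')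
    have hj : oneJet (heisHomeo (e.symm y).1 s) =
        ((e.symm y).1, affL (e.symm y).1 (cayley (a (e.symm y).2)) 1) := by
      rw [← hsσ]
      exact Prod.ext (by simp [oneJet, heisHomeo_eq]) (fderiv_of_eq_affL (heisHomeo_eq _ s) 0)
    refine ⟨⟨_, hΓ' (heisHomeo_mem_oriented (e.symm y).1 hs)⟩, ?_, hj⟩
    simp only [Set.mem_ofPred_eq, hj, affL_vert, horBlock_affL]
    exact ⟨one_pos, isUnit_one_add_cayley hy⟩
  · have h1 := (hcay f hf.1 hf.2).1
    simp only [Set.mem_ofPred_eq, ContinuousLinearEquiv.symm_apply_apply]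
    rw [haP _ h1]
    exact isUnit_one_add_cayley hf.2
  · obtain ⟨h1, h2⟩ := hcay f hf.1 hf.2
    simp only [ContinuousLinearEquiv.symm_apply_apply]
    rw [haP _ h1]
    rw [cayley_cayley hf.2]
    exact Prod.ext rfl h2.symm
  · simp only [horBlock_affL]
    rw [cayley_cayley hy, hPa]
    exact e.apply_symm_apply y

end LieGroup

/-! ### Choice of signs and counting -/

section Signs

variable {n : ℕ}

/-- Signs with `t` mixed pairs, then `m` negative pairs, and positive pairs from there on. -/
def blockSigns (n t m : ℕ) : Fin n ⊕ Fin n → ℤˣ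
  | .inl i => if (i : ℕ) < t then 1 else if (i : ℕ) < t + m then -1 else 1
  | .inr i => if (i : ℕ) < t + m then -1 else 1

lemma signIndex_blockSigns {t m : ℕ} (h : t + m ≤ n) :
    signIndex (blockSigns n t m) = t + 2 * m := by
  have hne : (1 : ℤˣ) ≠ -1 := by decide
  have hcard : ∀ k ≤ n, ∑ i : Fin n, (if (i : ℕ) < k then 1 else 0) = k := fun k hk => by
    rw [← Finset.card_filter, Fin.card_filter_val_lt, min_eq_right hk]
  have h1 : ∑ i : Fin n, (if blockSigns n t m (.inr i) = -1 then 1 else 0) = t + m := by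
    rw [← hcard (t + m) h]
    refine Finset.sum_congr rfl fun i _ => ?_
    by_cases h1 : (i : ℕ) < t + m <;> simp [blockSigns, h1, hne]
  -- The negative `x`-signs are the indices below `t + m` that are not below `t`; adding `t` avoids
  -- a truncated subtraction.
  have h2 : ∑ i : Fin n, (if blockSigns n t m (.inl i) = -1 then 1 else 0) + t = t + m := by
    refine (congrArg (_ + ·) (hcard t (by omega)).symm).trans ?_
    rw [← hcard (t + m) h, ← Finset.sum_add_distrib]
    refine Finset.sum_congr rfl fun i _ => ?_
    by_cases h2 : (i : ℕ) < t
    · have h1 : (i : ℕ) < t + m := by omega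
      simp [blockSigns, h1, h2, hne]
    · by_cases h1 : (i : ℕ) < t + m <;> simp [blockSigns, h1, h2, hne]
  rw [signIndex, Finset.card_filter, Fintype.sum_sum_type, h1]
  omega

/-- The sign products are `-1` on the first `t` indices and `1` on the rest, so the pairs form two
square blocks. -/
lemma card_pairSign_blockSigns {t m : ℕ} (h : t ≤ n) :
    Fintype.card {p : Fin n × Fin n //
      pairSign (blockSigns n t m) p.1 = pairSign (blockSigns n t m) p.2} =
      (n - t) ^ 2 + t ^ 2 := by
  have hne : (1 : ℤˣ) ≠ -1 := by decide
  have hp : ∀ i : Fin n, pairSign (blockSigns n t m) i = if (i : ℕ) < t then -1 else 1 := by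
    intro i
    by_cases h1 : (i : ℕ) < t
    · have h2 : (i : ℕ) < t + m := by omega
      simp [pairSign, blockSigns, h1, h2]
    · by_cases h2 : (i : ℕ) < t + m <;> simp [pairSign, blockSigns, h1, h2]
  have h1 : (Finset.univ.filter fun i : Fin n => (i : ℕ) < t).card = t := by
    rw [Fin.card_filter_val_lt, min_eq_right h]
  have h2 : (Finset.univ.filter fun i : Fin n => ¬(i : ℕ) < t).card = n - t := by
    have := Finset.card_filter_add_card_filter_not (s := (Finset.univ : Finset (Fin n)))
      (fun i : Fin n => (i : ℕ) < t)
    rw [h1, Finset.card_univ, Fintype.card_fin] at this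
    omega
  have h3 : ∀ i : Fin n, (∑ j : Fin n, if pairSign (blockSigns n t m) i =
      pairSign (blockSigns n t m) j then 1 else 0) = if (i : ℕ) < t then t else n - t := fun i => by
    simp only [hp]
    by_cases hi : (i : ℕ) < t
    · rw [if_pos hi, if_pos hi, ← Finset.card_filter, ← h1]
      congr 2
      ext j
      rw [h1]
      by_cases hj : (j : ℕ) < t <;> simp [hj, hne.symm]
    · rw [if_neg hi, if_neg hi, ← Finset.card_filter, ← h2]
      congr 2
      ext j
      by_cases hj : (j : ℕ) < t <;> simp [hj, hne]
  rw [Fintype.card_subtype, Finset.card_filter, Fintype.sum_prod_type]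
  simp only [h3]
  rw [Finset.sum_ite, Finset.sum_const, Finset.sum_const, h1, h2, smul_eq_mul, smul_eq_mul]
  ring

theorem exists_signs_isLieGroupOfDim (hn : 1 ≤ n) {l t : ℕ} (htl : t ≤ l) (hlt : l + t ≤ 2 * n)
    (he : Even (l - t)) :
    ∃ ε : Fin n ⊕ Fin n → ℤˣ, signIndex ε = l ∧
      IsLieGroupOfDim (isometryGroup (heisStructure ε)) ((2 * n + 1) + (n - t) ^ 2 + t ^ 2) ∧
      IsLieGroupOfDim (orientedIsometryGroup (heisStructure ε) heisFrame)
        ((2 * n + 1) + (n - t) ^ 2 + t ^ 2) := by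
  -- Here `l = t + 2m`: each mixed pair contributes one minus sign and each of the `m` negative
  -- pairs two. The bound `l + t ≤ 2n` says `t + m ≤ n`.
  obtain ⟨m, hm⟩ := he
  have hd : (2 * n + 1) + (n - t) ^ 2 + t ^ 2 =
      2 * n + 1 + Module.finrank ℝ (isoAlgebra (blockSigns n t m)) := by
    rw [finrank_isoAlgebra, card_pairSign_blockSigns (by omega)]
    ring
  have hle : orientedIsometryGroup (heisStructure (blockSigns n t m)) heisFrame ≤
      isometryGroup (heisStructure (blockSigns n t m)) := fun f hf => hf.1
  refine ⟨blockSigns n t m, ?_, isLieGroupOfDim_of_oriented_le hn le_rfl hle hd,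
    isLieGroupOfDim_of_oriented_le hn hle le_rfl hd⟩
  rw [signIndex_blockSigns (by omega)]
  omega

end Signs

end

/-! ### The main theorem -/

theorem proposition4 (n : ℕ) (hn : 1 ≤ n) :
    (∀ ε : Fin n ⊕ Fin n → ℤˣ,
      IsOrthonormalFrame (heisStructure ε) heisFrame ε ∧
      IsNormalizedContactForm (heisStructure ε) heisFrame heisContactForm ∧
      IsBracketGenerating (heisFrame (n := n)) ∧
      (∀ (q v w : HeisPt n), -dOneForm heisContactForm q v w = stdSymp v.1 w.1) ∧
      (∀ (p q : HeisPt n) (a : Fin n ⊕ Fin n),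
        fderiv ℝ (heisMul p) q (heisFrame a q) = heisFrame a (heisMul p q)) ∧
      ∃ Φ : Heis n ⋊[heisAction ε] (spGroup n ⊓ oGroup ε : Subgroup (GL (Fin n ⊕ Fin n) ℝ)) ≃*
          orientedIsometryGroup (heisStructure ε) heisFrame,
        (∀ s q, (Φ s).1 q = heisMul s.left.toPt (fSigma s.right.1 q)) ∧
        IsHomeomorph (fun r : Heis n ×
          (spGroup n ⊓ oGroup ε : Subgroup (GL (Fin n ⊕ Fin n) ℝ)) => Φ ⟨r.1, r.2⟩)) ∧
    (∀ l t : ℕ, t ≤ l → l + t ≤ 2 * n → Even (l - t) →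
      ∃ ε : Fin n ⊕ Fin n → ℤˣ, signIndex ε = l ∧
        IsLieGroupOfDim (isometryGroup (heisStructure ε))
          ((2 * n + 1) + (n - t) ^ 2 + t ^ 2) ∧
        IsLieGroupOfDim (orientedIsometryGroup (heisStructure ε) heisFrame)
          ((2 * n + 1) + (n - t) ^ 2 + t ^ 2)) ∧
    (∀ l : ℕ, l ≤ 2 * n → (Even l ∨ l = n) →
      ∃ ε : Fin n ⊕ Fin n → ℤˣ, signIndex ε = l ∧
        IsLieGroupOfDim (isometryGroup (heisStructure ε)) ((2 * n + 1) + n ^ 2)) ∧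
    (∀ l : ℕ, l ≤ 2 * n → Odd l → l ≠ n →
      ∃ ε : Fin n ⊕ Fin n → ℤˣ, signIndex ε = l ∧
        IsLieGroupOfDim (isometryGroup (heisStructure ε))
          ((2 * n + 1) + (n - 1) ^ 2 + 1)) := by
  refine ⟨fun ε => ⟨isOrthonormalFrame_heisFrame ε, isNormalizedContactForm_heisContactForm ε,
    isBracketGenerating_heisFrame hn, fun q v w => by rw [dOneForm_heisContactForm, neg_neg],
    fderiv_heisMul_heisFrame,
    MulEquiv.ofBijective (semidirectToIsometry ε) (bijective_semidirectToIsometry ε hn),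
    semidirectToIsometry_apply ε, isHomeomorph_semidirectToIsometry ε hn⟩,
    fun l t h1 h2 h3 => exists_signs_isLieGroupOfDim hn h1 h2 h3, fun l hl h => ?_,
    fun l hl ho hne => ?_⟩
  · by_cases he : Even l
    -- For even index no mixed pairs are needed.
    · obtain ⟨ε, h1, h2, -⟩ := exists_signs_isLieGroupOfDim hn (t := 0) (Nat.zero_le l)
        (by omega) (by simpa using he)
      exact ⟨ε, h1, by simpa using h2⟩
    · obtain rfl := h.resolve_left he
      -- For `l = n` odd, all pairs are mixed (`t = n`), which again gives `n^2`.
      obtain ⟨ε, h1, h2, -⟩ := exists_signs_isLieGroupOfDim hn (le_refl l) (by omega) (by simp)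
      exact ⟨ε, h1, by simpa using h2⟩
  · obtain ⟨k, rfl⟩ := ho
    -- One mixed pair repairs the parity; an odd `l ≤ 2n` satisfies `l + 1 ≤ 2n`.
    obtain ⟨ε, h1, h2, -⟩ := exists_signs_isLieGroupOfDim hn (l := 2 * k + 1) (t := 1) (by omega)
      (by omega) (by simp)
    exact ⟨ε, h1, by simpa using h2⟩
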